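/- \textbf{Setting.} Let $A$ be a unital $C^*$-algebra with a strongly continuous action $\sigma$ of the circle $S^1\subseteq\mathbb{C}$ by $*$-automorphisms. For $n\in\mathbb{Z}$ put $A_n:=\{a\in A : \sigma_\lambda(a)=\lambda^n a \text{ for all } \lambda\in S^1\}$ and let $P_0:A\to A_0$, $P_0(a)=\frac{1}{2\pi}\int_0^{2\pi}\sigma_{e^{it}}(a)\,dt$. Let $\ell(e^{it})=|t|$ for $t\in(-\pi,\pi]$, let $\operatorname{Lip}_{S^1}(A)$ be the set of $a\in A$ for which $\{(\sigma_\lambda(a)-a)/\ell(\lambda) : \lambda\in S^1\setminus\{1\}\}$ is norm bounded, and for such $a$ put $L_\ell(a):=\sup_{\lambda\neq 1}\|\sigma_\lambda(a)-a\|/\ell(\lambda)$. A slip-norm on an operator system $\mathcal{E}\subseteq A$ (a vector subspace, not necessarily closed, containing $1$ and closed under the adjoint) is a seminorm $L:\mathcal{E}\to[0,\infty)$ with $L(1)=0$ and $L(x^*)=L(x)$; it is lower semicontinuous if $\{x\in\mathcal{E}: L(x)>y\}$ is open in $\mathcal{E}$ for all $y\ge 0$. The pair $(\mathcal{E},L)$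 is a compact quantum metric space if the weak$^*$-topology on the state space of $\mathcal{E}$ (the unital positive functionals $\mathcal{E}\to\mathbb{C}$) agrees with the metric topology of the extended metric $d_L(\mu,\nu)=\sup\{|\mu(x)-\nu(x)| : x\in\mathcal{E},\ L(x)\le 1\}$. \textbf{Theorem.} Let $\mathcal{A}\subseteq A$ be a norm-dense unital $*$-subalgebra, let $B$ be a unital $C^*$-algebra, let $\beta_i:\mathcal{A}\to B$ be a unital algebra homomorphism (not assumed to preserve the involution), and put $\beta_{-i}(a):=\beta_i(a^*)^*$. Let $L$ and $L_\beta:\mathcal{A}\to[0,\infty)$ be slip-norms. Suppose that: \begin{enumerate} \item $\sigma_\lambda(\mathcal{A})\subseteq\mathcal{A}$ for all $\lambda\in S^1$ and $\mathcal{A}\subseteq\operatorname{Lip}_{S^1}(A)$; \item $P_0(\mathcal{A})\subseteq\mathcal{A}$ and there exist finitely many elements $\zeta^R_1,\dots,\zeta^R_k$ and $\zeta^L_1,\dots,\zeta^L_m$ in $\mathcal{A}\cap A_1$ such that $\sum_{j=1}^k\zeta^R_j(\zeta^R_j)^*=1=\sum_{j=1}^m(\zeta^L_j)^*\zeta^L_j$;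 \item there exists a constant $C\ge 0$ such that $L_\ell(a)\le C\cdot L(a)$ and $L_\beta(a)\le C\cdot L(a)$ for all $a\in\mathcal{A}$; \item $L_\beta(ab)\le L_\beta(a)\cdot\|\beta_i(b)\|+\|\beta_{-i}(a)\|\cdot L_\beta(b)$ for all $a,b\in\mathcal{A}$, and the restriction $\beta_i:\mathcal{A}\cap A_0\to B$ extends to a unital $*$-homomorphism $A_0\to B$; \item $L_\beta$ is lower semicontinuous and $L_\beta(\sigma_\lambda(a))=L_\beta(a)$ for all $a\in\mathcal{A}$ and $\lambda\in S^1$; \item the pair $(\mathcal{A}\cap A_0, L_\beta)$ is a compact quantum metric space. \end{enumerate} Then $(\mathcal{A},L)$ is a compact quantum metric space. -/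

import Mathlib

open scoped ComplexOrder

noncomputable section

universe u

section OperatorSystems

variable {A : Type u} [CStarAlgebra A]

/-- A concrete operator system in a unital C*-algebra `A`: a vector subspace, not necessarily
closed, that contains the unit and is stable under the adjoint. -/
structure OperatorSystem (A : Type u) [CStarAlgebra A] extends Submodule ℂ A where
  one_mem' : (1 : A) ∈ toSubmodule
  star_mem' : ∀ x : A, x ∈ toSubmodule → star x ∈ toSubmodule

/-- The operator system underlying a unital *-subalgebra. -/
def OperatorSystem.ofStarSubalgebra (S : StarSubalgebra ℂ A) : OperatorSystem A where
  toSubmodule := Subalgebra.toSubmodule S.toSubalgebra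
  one_mem' := one_mem S
  star_mem' := fun _ hx => star_mem (s := S) hx

/-- A slip-norm on an operator system `E`: a (finite, complex) semi-norm on `E` which vanishes on
the unit and is invariant under the adjoint. -/
structure SlipNorm (E : OperatorSystem A) extends Seminorm ℂ E.toSubmodule where
  map_one' : toFun ⟨1, E.one_mem'⟩ = 0
  map_star' : ∀ (x : A) (hx : x ∈ E.toSubmodule),
    toFun ⟨star x, E.star_mem' x hx⟩ = toFun ⟨x, hx⟩

instance (E : OperatorSystem A) : CoeFun (SlipNorm E) (fun _ => E.toSubmodule → ℝ) where
  coe L := L.toSeminorm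

/-- Restriction of a slip-norm to a smaller operator system. -/
def SlipNorm.restrict {E F : OperatorSystem A} (L : SlipNorm E)
    (h : F.toSubmodule ≤ E.toSubmodule) : SlipNorm F where
  toSeminorm := L.toSeminorm.comp (Submodule.inclusion h)
  map_one' := L.map_one'
  map_star' := fun x hx => L.map_star' x (h hx)

/-- Lower semicontinuity of a slip-norm with respect to the C*-norm on `E`. -/
def SlipNorm.IsLSC {E : OperatorSystem A} (L : SlipNorm E) : Prop :=
  LowerSemicontinuous (fun x : E.toSubmodule => L x)

variable [PartialOrder A] [StarOrderedRing A]

/-- The state space of an operator system: the unital positive linear functionals, where an element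
of `E` is positive if it is positive in the ambient C*-algebra. -/
structure StateSpace (E : OperatorSystem A) extends E.toSubmodule →ₗ[ℂ] ℂ where
  map_one' : toFun ⟨1, E.one_mem'⟩ = 1
  map_nonneg' : ∀ x : E.toSubmodule, 0 ≤ (x : A) → 0 ≤ toFun x

instance (E : OperatorSystem A) : CoeFun (StateSpace E) (fun _ => E.toSubmodule → ℂ) where
  coe μ := μ.toLinearMap

/-- The weak* topology on the state space: the topology of pointwise convergence on `E`. -/
@[reducible] def StateSpace.weakStar (E : OperatorSystem A) : TopologicalSpace (StateSpace E) :=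
  TopologicalSpace.induced (fun μ (x : E.toSubmodule) => μ x) inferInstance

/-- The Monge-Kantorovich extended metric
`d_L(μ, ν) = sup { |μ(x) - ν(x)| : L(x) ≤ 1 }` in `[0, ∞]`. -/
def SlipNorm.mongeKantorovich {E : OperatorSystem A} (L : SlipNorm E) (μ ν : StateSpace E) :
    ENNReal :=
  ⨆ (x : E.toSubmodule) (_ : L x ≤ 1), ENNReal.ofReal ‖μ x - ν x‖

/-- The topology on the state space with the open balls of finite radius for the Monge-Kantorovich
extended metric as a basis. -/
@[reducible] def SlipNorm.metricTopology {E : OperatorSystem A} (L : SlipNorm E) :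
    TopologicalSpace (StateSpace E) :=
  TopologicalSpace.generateFrom
    {U | ∃ (μ : StateSpace E) (r : ℝ), U = {ν | L.mongeKantorovich μ ν < ENNReal.ofReal r}}

/-- `(E, L)` is a compact quantum metric space if the Monge-Kantorovich extended metric induces the
weak* topology on the state space. -/
def SlipNorm.IsCompactQuantumMetric {E : OperatorSystem A} (L : SlipNorm E) : Prop :=
  StateSpace.weakStar E = L.metricTopology

end OperatorSystems

section CircleActions

variable {A : Type u} [CStarAlgebra A]

/-- Strong continuity of an action of the circle by *-automorphisms. -/
def IsStronglyContinuous (σ : Circle →* (A ≃⋆ₐ[ℂ] A)) : Prop :=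
  ∀ a : A, Continuous (fun z : Circle => σ z a)

/-- The spectral subspace `A_n = { a | σ_z(a) = z^n a for all z }`. -/
def spectralSubspace (σ : Circle →* (A ≃⋆ₐ[ℂ] A)) (n : ℤ) : Submodule ℂ A where
  carrier := {a | ∀ z : Circle, σ z a = ((z : ℂ) ^ n) • a}
  zero_mem' := fun z => by simp
  add_mem' := fun {a b} ha hb z => by
    rw [map_add, ha z, hb z, smul_add]
  smul_mem' := fun c a ha z => by
    rw [map_smul, ha z, smul_comm]

/-- The fixed point algebra `A_0`, as a unital *-subalgebra. -/
def fixedPointAlgebra (σ : Circle →* (A ≃⋆ₐ[ℂ] A)) : StarSubalgebra ℂ A where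
  carrier := {a | ∀ z : Circle, σ z a = a}
  mul_mem' := fun {a b} ha hb z => by rw [map_mul, ha z, hb z]
  add_mem' := fun {a b} ha hb z => by rw [map_add, ha z, hb z]
  algebraMap_mem' := fun c z => by
    rw [Algebra.algebraMap_eq_smul_one, map_smul, map_one]
  star_mem' := fun {a} ha z => by rw [map_star, ha z]

theorem mem_fixedPointAlgebra_iff (σ : Circle →* (A ≃⋆ₐ[ℂ] A)) (a : A) :
    a ∈ fixedPointAlgebra σ ↔ a ∈ spectralSubspace σ 0 := by
  change (∀ z : Circle, σ z a = a) ↔ (∀ z : Circle, σ z a = ((z : ℂ) ^ (0 : ℤ)) • a)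
  simp

/-- The spectral projection `P_n(a) = (1/2π) ∫_0^{2π} e^{-itn} σ_{e^{it}}(a) dt`. -/
def spectralProj (σ : Circle →* (A ≃⋆ₐ[ℂ] A)) (n : ℤ) (a : A) : A :=
  ((2 * Real.pi : ℝ)⁻¹ : ℂ) •
    ∫ t in (0 : ℝ)..(2 * Real.pi), Complex.exp (-(Complex.I * t * n)) • σ (Circle.exp t) a

/-- The arc length function `ℓ(e^{it}) = |t|` for `t ∈ (-π, π]`. -/
def circleLength (z : Circle) : ℝ := |Complex.arg (z : ℂ)|

/-- The difference quotients `‖σ_z(a) - a‖ / ℓ(z)`, for `z ≠ 1`. -/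
def circleQuotient (σ : Circle →* (A ≃⋆ₐ[ℂ] A)) (a : A) (z : {z : Circle // z ≠ 1}) : ℝ :=
  ‖σ z a - a‖ / circleLength z

/-- The Lipschitz elements of the circle action. -/
def circleLip (σ : Circle →* (A ≃⋆ₐ[ℂ] A)) : Set A :=
  {a | BddAbove (Set.range (circleQuotient σ a))}

/-- The semi-norm `L_ℓ(a) = sup_{z ≠ 1} ‖σ_z(a) - a‖ / ℓ(z)`; it is meant for `a ∈ circleLip σ`. -/
def circleSlip (σ : Circle →* (A ≃⋆ₐ[ℂ] A)) (a : A) : ℝ :=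
  ⨆ z : {z : Circle // z ≠ 1}, circleQuotient σ a z

end CircleActions

/-- For an algebra homomorphism `β_i : S → B`, the algebra homomorphism
`β_{-i}(a) = β_i(a*)*`, as a function. -/
def conjTwist {A : Type*} {B : Type*} [CStarAlgebra A] [CStarAlgebra B] {S : StarSubalgebra ℂ A}
    (β : S →ₐ[ℂ] B) (a : S) : B :=
  star (β (star a))

end

/-!
A pair `(E, L)` is a compact quantum metric space exactly when the Lipschitz ball `{L ≤ 1}` is
totally bounded modulo the scalars. If it is, finitely many elements control the metric up to `ε`
(`SlipNorm.isCompactQuantumMetric_of_totallyBounded`). Conversely, the state space is weak-star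
compact and convex: compactness gives a finite cover by metric balls of radius `ε`, and following
segments shows that distances are finite; as states detect the norm up to a factor `2`, the values
on the finitely many centers determine an element of the ball up to a multiple of `ε`
(`SlipNorm.IsCompactQuantumMetric.totallyBounded`).

It remains to carry total boundedness from the fixed points of the circle action to the whole
algebra. Since `L_ℓ ≤ C L`, averaging against the trigonometric polynomial `((1 + cos t) / 2) ^ N`
approximates all `a` with `L a ≤ 1` uniformly by a finite combination of the projections `P_n a`
(`exists_norm_sub_sum_spectralProj_le`), so it is enough to treat each `P_n` separately. For `n = 0`
lower semicontinuity and invariance give `L_β (P_0 a) ≤ L_β a ≤ C`, and the hypothesis on the fixed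
points applies. For `n > 0` products of the `ζ^L` are elements `ξ_j` of degree `n` with
`∑ ξ_j* ξ_j = 1`, so that `P_n a = ∑ (P_n a ξ_j*) ξ_j` with coefficients in the fixed point algebra.
The twisted Leibniz rule bounds `L_β` of these coefficients, because `β` is bounded on each spectral
subspace: the `ζ^R` reduce this to the fixed points, where `β` is a *-homomorphism between
C*-algebras and hence contractive (`totallyBounded_image_spectralProj`). The case `n < 0` follows by
taking adjoints.
-/

/-! ### States of operator systems -/

section States

variable {A : Type*} [CStarAlgebra A] {E : OperatorSystem A}

theorem OperatorSystem.realPart_mem {x : A} (hx : x ∈ E.toSubmodule) :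
    ((realPart x : selfAdjoint A) : A) ∈ E.toSubmodule := by
  rw [realPart_apply_coe]
  have := E.toSubmodule.smul_mem ((2 : ℂ)⁻¹) (E.toSubmodule.add_mem hx (E.star_mem' x hx))
  convert this using 1
  rw [← Complex.coe_smul]; norm_num

theorem OperatorSystem.imaginaryPart_mem {x : A} (hx : x ∈ E.toSubmodule) :
    ((imaginaryPart x : selfAdjoint A) : A) ∈ E.toSubmodule := by
  have h := E.realPart_mem (E.toSubmodule.smul_mem (-Complex.I) hx)
  simpa [realPart_I_smul] using h

theorem OperatorSystem.eq_realPart_add (x : E.toSubmodule) :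
    x = ⟨_, E.realPart_mem x.2⟩ + Complex.I • ⟨_, E.imaginaryPart_mem x.2⟩ :=
  Subtype.ext (realPart_add_I_smul_imaginaryPart (x : A)).symm

variable [PartialOrder A]

/-- The state of `E` that a unital positive functional on the ambient algebra restricts to. -/
noncomputable def StateSpace.ofFunctional (E : OperatorSystem A) (g : A →ₗ[ℂ] ℂ) (h1 : g 1 = 1)
    (hg : ∀ y, 0 ≤ y → 0 ≤ g y) : StateSpace E where
  toLinearMap := g.comp E.toSubmodule.subtype
  map_one' := h1
  map_nonneg' := fun x hx => hg x hx

/-- Restriction of states to a smaller operator system. -/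
noncomputable def StateSpace.restrict {F : OperatorSystem A} (μ : StateSpace E)
    (h : F.toSubmodule ≤ E.toSubmodule) : StateSpace F where
  toLinearMap := μ.toLinearMap.comp (Submodule.inclusion h)
  map_one' := μ.map_one'
  map_nonneg' := fun x hx => μ.map_nonneg' (Submodule.inclusion h x) hx

theorem StateSpace.nontrivial (μ : StateSpace E) : Nontrivial A := by
  by_contra hA
  rw [not_nontrivial_iff_subsingleton] at hA
  have h1 : μ ⟨1, E.one_mem'⟩ = 1 := μ.map_one'
  have h0 : (⟨1, E.one_mem'⟩ : E.toSubmodule) = 0 := Subsingleton.elim _ _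
  rw [h0, map_zero] at h1
  exact zero_ne_one h1

variable [StarOrderedRing A]

/-- The functional `a + b x ↦ a + b r` on the span of `1` and `x` is positive because `r` lies in
the spectrum of `x`; M. Riesz' theorem extends it from there, the cone being the elements with
positive real part, so that the extension vanishes on `i` times the self-adjoint elements. -/
theorem exists_positive_functional_apply_eq {x : A} (hx : IsSelfAdjoint x) {r : ℝ}
    (hr : r ∈ spectrum ℝ x) :
    ∃ g : A →ₗ[ℂ] ℂ, g 1 = 1 ∧ (∀ y, 0 ≤ y → 0 ≤ g y) ∧ g x = r := by
  let j : (ℝ × ℝ) →ₗ[ℝ] A :=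
    (LinearMap.fst ℝ ℝ ℝ).smulRight 1 + (LinearMap.snd ℝ ℝ ℝ).smulRight x
  have j_apply (a b : ℝ) : j (a, b) = a • (1 : A) + b • x := rfl
  let h : (ℝ × ℝ) →ₗ[ℝ] ℝ := LinearMap.fst ℝ ℝ ℝ + r • LinearMap.snd ℝ ℝ ℝ
  have h_apply (a b : ℝ) : h (a, b) = a + r * b := rfl
  have hspec (a b : ℝ) : a + r * b ∈ spectrum ℝ (a • (1 : A) + b • x) := by
    have h1 := spectrum.subset_polynomial_aeval (𝕜 := ℝ) x
      (Polynomial.C a + Polynomial.C b * Polynomial.X)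
    have h2 := h1 ⟨r, hr, rfl⟩
    simp only [Polynomial.eval_add, Polynomial.eval_C, Polynomial.eval_mul, Polynomial.eval_X,
      map_add, map_mul, Polynomial.aeval_C, Polynomial.aeval_X,
      Algebra.algebraMap_eq_smul_one, smul_mul_assoc, one_mul] at h2
    rwa [mul_comm r b]
  have hnontriv : Nontrivial A := by
    rcases subsingleton_or_nontrivial A with hs | hn
    · simp [spectrum.of_subsingleton] at hr
    · exact hn
  have hker : h ∈ (LinearMap.ker j).dualAnnihilator := by
    rw [Submodule.mem_dualAnnihilator]
    rintro ⟨a, b⟩ hab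
    have h1 := hspec a b
    rw [LinearMap.mem_ker, j_apply] at hab
    rw [hab, spectrum.zero_eq] at h1
    simpa [h_apply] using h1
  rw [← LinearMap.range_dualMap_eq_dualAnnihilator_ker] at hker
  obtain ⟨f, hf⟩ := hker
  have f_apply (a b : ℝ) : f (a • (1 : A) + b • x) = a + r * b := by
    rw [← j_apply, ← h_apply, ← hf]; rfl
  let s : PointedCone ℝ A :=
    { carrier := {y | 0 ≤ ((realPart y : selfAdjoint A) : A)}
      add_mem' := fun {a b} ha hb => by
        simp only [Set.mem_ofPred_eq, map_add, AddSubgroup.coe_add] at *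
        exact add_nonneg ha hb
      zero_mem' := by simp
      smul_mem' := fun c y hy => by
        have : realPart (c • y) = (c : ℝ) • realPart y := by
          rw [← map_smul]; rfl
        simp only [Set.mem_ofPred_eq] at *
        rw [this]
        exact smul_nonneg c.2 hy }
  have mem_s (y : A) : y ∈ s ↔ 0 ≤ ((realPart y : selfAdjoint A) : A) := Iff.rfl
  have mem_s_sa {y : A} (hy : IsSelfAdjoint y) : y ∈ s ↔ 0 ≤ y := by
    rw [mem_s, hy.coe_realPart]
  have hsa (a b : ℝ) : IsSelfAdjoint (a • (1 : A) + b • x) := by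
    refine IsSelfAdjoint.add ?_ ?_
    · exact (IsSelfAdjoint.all a).smul (.one A)
    · exact (IsSelfAdjoint.all b).smul hx
  obtain ⟨g, hg, hgs⟩ := riesz_extension s ⟨LinearMap.range j, f.domRestrict _⟩ (by
      rintro ⟨_, ⟨a, b⟩, rfl⟩ hs
      change (j (a, b)) ∈ s at hs
      change 0 ≤ f (j (a, b))
      rw [j_apply] at hs ⊢
      rw [f_apply]
      exact spectrum_nonneg_of_nonneg ((mem_s_sa (hsa a b)).1 hs) (hspec a b)) (by
      intro y
      refine ⟨⟨j (‖((realPart y : selfAdjoint A) : A)‖, 0), _, rfl⟩, ?_⟩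
      change j (‖((realPart y : selfAdjoint A) : A)‖, 0) + y ∈ s
      rw [mem_s, j_apply, zero_smul, add_zero, map_add, AddSubgroup.coe_add]
      rw [IsSelfAdjoint.coe_realPart ((IsSelfAdjoint.all _).smul (.one A)),
        ← Algebra.algebraMap_eq_smul_one]
      have := (realPart y).2.neg_algebraMap_norm_le_self
      exact neg_le_iff_add_nonneg'.1 this)
  have g_apply (a b : ℝ) : g (a • (1 : A) + b • x) = a + r * b := by
    rw [← f_apply]
    exact hg ⟨j (a, b), _, rfl⟩
  -- both `i y` and `-i y` have real part `0`
  have g_I {y : A} (hy : IsSelfAdjoint y) : g (Complex.I • y) = 0 := by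
    have h0 : realPart (Complex.I • y) = 0 := by
      rw [realPart_I_smul, hy.imaginaryPart, neg_zero]
    apply le_antisymm
    · have : 0 ≤ g (-(Complex.I • y)) := hgs _ ((mem_s _).2 (by rw [map_neg, h0]; simp))
      simpa using this
    · exact hgs _ ((mem_s _).2 (by rw [h0]; simp))
  have ext_apply (y : A) :
      Module.Dual.extendRCLike (𝕜 := ℂ) g y = g y - Complex.I * g (Complex.I • y) := by
    simp [Module.Dual.extendRCLike_apply]
  refine ⟨Module.Dual.extendRCLike (𝕜 := ℂ) g, ?_, fun y hy => ?_, ?_⟩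
  · rw [ext_apply, g_I (.one A)]
    have := g_apply 1 0
    simp at this
    simp [this]
  · rw [ext_apply, g_I (.of_nonneg hy)]
    simpa using hgs y ((mem_s_sa (.of_nonneg hy)).2 hy)
  · rw [ext_apply, g_I hx]
    have := g_apply 0 1
    simp at this
    simp [this]

theorem StateSpace.apply_le_norm_of_isSelfAdjoint (μ : StateSpace E) {x : E.toSubmodule}
    (hx : IsSelfAdjoint (x : A)) : μ x ≤ ((‖(x : A)‖ : ℝ) : ℂ) := by
  have h1 : μ ⟨1, E.one_mem'⟩ = 1 := μ.map_one'
  have h2 : (0 : A) ≤ ((((‖(x : A)‖ : ℝ) : ℂ) • ⟨1, E.one_mem'⟩ - x : E.toSubmodule) : A) := by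
    have := hx.le_algebraMap_norm_self
    rw [Algebra.algebraMap_eq_smul_one] at this
    simpa using this
  have h3 : 0 ≤ μ (((‖(x : A)‖ : ℝ) : ℂ) • ⟨1, E.one_mem'⟩ - x) := μ.map_nonneg' _ h2
  rw [map_sub, map_smul, h1] at h3
  simpa using h3

theorem StateSpace.ofReal_re_apply_of_isSelfAdjoint (μ : StateSpace E) {x : E.toSubmodule}
    (hx : IsSelfAdjoint (x : A)) : ((μ x).re : ℂ) = μ x := by
  have h := (Complex.le_def.1 (μ.apply_le_norm_of_isSelfAdjoint hx)).2
  exact Complex.ext rfl (by simpa using h.symm)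

theorem StateSpace.norm_apply_le_of_isSelfAdjoint (μ : StateSpace E) {x : E.toSubmodule}
    (hx : IsSelfAdjoint (x : A)) : ‖μ x‖ ≤ ‖(x : A)‖ := by
  have h2 := (Complex.le_def.1 (μ.apply_le_norm_of_isSelfAdjoint hx)).1
  have h3 := (Complex.le_def.1
    (μ.apply_le_norm_of_isSelfAdjoint (x := -x) (by simpa using hx.neg))).1
  simp only [map_neg, Complex.neg_re, Complex.ofReal_re, Submodule.coe_neg, norm_neg] at h2 h3
  rw [← μ.ofReal_re_apply_of_isSelfAdjoint hx, Complex.norm_real, Real.norm_eq_abs, abs_le]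
  constructor <;> linarith

/-- The constant `1` also holds; `2` is what the splitting into real and imaginary parts gives. -/
theorem StateSpace.norm_apply_le (μ : StateSpace E) (x : E.toSubmodule) :
    ‖μ x‖ ≤ 2 * ‖(x : A)‖ := by
  have h1 := μ.norm_apply_le_of_isSelfAdjoint (x := ⟨_, E.realPart_mem x.2⟩) (realPart (x : A)).2
  have h2 := μ.norm_apply_le_of_isSelfAdjoint (x := ⟨_, E.imaginaryPart_mem x.2⟩)
    (imaginaryPart (x : A)).2
  have h3 := realPart.norm_le (x : A)
  have h4 := imaginaryPart.norm_le (x : A)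
  calc ‖μ x‖ = ‖μ ⟨_, E.realPart_mem x.2⟩ + Complex.I • μ ⟨_, E.imaginaryPart_mem x.2⟩‖ := by
        conv_lhs => rw [OperatorSystem.eq_realPart_add x, map_add, map_smul]
    _ ≤ ‖μ ⟨_, E.realPart_mem x.2⟩‖ + ‖Complex.I • μ ⟨_, E.imaginaryPart_mem x.2⟩‖ :=
        norm_add_le _ _
    _ ≤ 2 * ‖(x : A)‖ := by
        rw [norm_smul, Complex.norm_I, one_mul]
        simp only [AddSubgroup.coe_norm] at h3 h4
        linarith

theorem norm_le_of_forall_state_of_isSelfAdjoint [Nontrivial A] {x : E.toSubmodule}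
    (hx : IsSelfAdjoint (x : A)) {r : ℝ} (h : ∀ μ : StateSpace E, ‖μ x‖ ≤ r) :
    ‖(x : A)‖ ≤ r := by
  rcases CStarAlgebra.norm_or_neg_norm_mem_spectrum hx with hn | hn <;>
  · obtain ⟨g, h1, hg, hgx⟩ := exists_positive_functional_apply_eq hx hn
    have h2 : ‖g x‖ ≤ r := h (StateSpace.ofFunctional E g h1 hg)
    rw [hgx, Complex.norm_real] at h2
    simpa using h2

/-- States detect the norm of self-adjoint elements, so they detect the norm up to a factor `2`. -/
theorem norm_le_of_forall_state [Nontrivial A] {x : E.toSubmodule} {r : ℝ}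
    (h : ∀ μ : StateSpace E, ‖μ x‖ ≤ r) : ‖(x : A)‖ ≤ 2 * r := by
  have hdecomp (μ : StateSpace E) : ((μ ⟨_, E.realPart_mem x.2⟩).re : ℂ)
      + Complex.I * (μ ⟨_, E.imaginaryPart_mem x.2⟩).re = μ x := by
    conv_rhs => rw [OperatorSystem.eq_realPart_add x, map_add, map_smul]
    rw [μ.ofReal_re_apply_of_isSelfAdjoint (x := ⟨_, E.realPart_mem x.2⟩)
      (realPart (x : A)).2,
      μ.ofReal_re_apply_of_isSelfAdjoint (x := ⟨_, E.imaginaryPart_mem x.2⟩)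
      (imaginaryPart (x : A)).2, smul_eq_mul]
  have hre (μ : StateSpace E) : ‖μ ⟨_, E.realPart_mem x.2⟩‖ ≤ r := by
    rw [← μ.ofReal_re_apply_of_isSelfAdjoint (x := ⟨_, E.realPart_mem x.2⟩)
      (realPart (x : A)).2, Complex.norm_real]
    have h1 := (Complex.abs_re_le_norm (μ x)).trans (h μ)
    rw [← hdecomp μ] at h1
    simpa using h1
  have him (μ : StateSpace E) : ‖μ ⟨_, E.imaginaryPart_mem x.2⟩‖ ≤ r := by
    rw [← μ.ofReal_re_apply_of_isSelfAdjoint (x := ⟨_, E.imaginaryPart_mem x.2⟩)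
      (imaginaryPart (x : A)).2, Complex.norm_real]
    have h1 := (Complex.abs_im_le_norm (μ x)).trans (h μ)
    rw [← hdecomp μ] at h1
    simpa using h1
  have h1 := norm_le_of_forall_state_of_isSelfAdjoint (x := ⟨_, E.realPart_mem x.2⟩)
    (realPart (x : A)).2 hre
  have h2 := norm_le_of_forall_state_of_isSelfAdjoint (x := ⟨_, E.imaginaryPart_mem x.2⟩)
    (imaginaryPart (x : A)).2 him
  calc ‖(x : A)‖ = ‖((realPart (x : A) : selfAdjoint A) : A)
        + Complex.I • ((imaginaryPart (x : A) : selfAdjoint A) : A)‖ := by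
        rw [realPart_add_I_smul_imaginaryPart]
    _ ≤ ‖((realPart (x : A) : selfAdjoint A) : A)‖
        + ‖Complex.I • ((imaginaryPart (x : A) : selfAdjoint A) : A)‖ := norm_add_le _ _
    _ ≤ 2 * r := by
        rw [norm_smul, Complex.norm_I, one_mul]
        linarith

/-- Banach-Alaoglu for the state space. -/
theorem StateSpace.isCompact_univ_weakStar :
    @IsCompact _ (StateSpace.weakStar E) Set.univ := by
  let := StateSpace.weakStar E
  have hind : Topology.IsInducing (fun (μ : StateSpace E) (x : E.toSubmodule) => μ x) := ⟨rfl⟩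
  rw [hind.isCompact_iff]
  have hrange : (fun (μ : StateSpace E) (x : E.toSubmodule) => μ x) '' Set.univ
      = Set.univ.pi (fun x : E.toSubmodule => Metric.closedBall (0 : ℂ) (2 * ‖(x : A)‖)) ∩
        {f | (∀ x y, f (x + y) = f x + f y) ∧ (∀ (c : ℂ) x, f (c • x) = c • f x) ∧
          f ⟨1, E.one_mem'⟩ = 1 ∧ ∀ x : E.toSubmodule, 0 ≤ (x : A) → 0 ≤ f x} := by
    ext f
    constructor
    · rintro ⟨μ, -, rfl⟩
      exact ⟨fun x _ => by simpa using μ.norm_apply_le x, map_add μ.toLinearMap,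
        map_smul μ.toLinearMap, μ.map_one', μ.map_nonneg'⟩
    · rintro ⟨-, h1, h2, h3, h4⟩
      exact ⟨⟨⟨⟨f, h1⟩, h2⟩, h3, h4⟩, trivial, rfl⟩
  rw [hrange]
  refine (isCompact_univ_pi fun x => isCompact_closedBall _ _).inter_right ?_
  simp only [Set.ofPred_and, Set.ofPred_forall]
  refine IsClosed.inter ?_ (IsClosed.inter ?_ (IsClosed.inter ?_ ?_))
  · exact isClosed_iInter fun x => isClosed_iInter fun y =>
      isClosed_eq (continuous_apply _) ((continuous_apply x).fun_add (continuous_apply y))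
  · exact isClosed_iInter fun c => isClosed_iInter fun x =>
      isClosed_eq (continuous_apply _) ((continuous_apply x).const_smul c)
  · exact isClosed_eq (continuous_apply _) continuous_const
  · exact isClosed_iInter fun x => isClosed_iInter fun _ =>
      isClosed_le continuous_const (continuous_apply _)

end States

/-! ### Compact quantum metric spaces and total boundedness -/

section TotalBoundedness

variable {A : Type*} [CStarAlgebra A] [PartialOrder A] {E : OperatorSystem A} (L : SlipNorm E)

namespace SlipNorm

theorem mongeKantorovich_self (μ : StateSpace E) : L.mongeKantorovich μ μ = 0 := by
  simp [mongeKantorovich]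

theorem mongeKantorovich_triangle (μ ν ρ : StateSpace E) :
    L.mongeKantorovich μ ρ ≤ L.mongeKantorovich μ ν + L.mongeKantorovich ν ρ := by
  refine iSup₂_le fun x hx => ?_
  calc ENNReal.ofReal ‖μ x - ρ x‖
      ≤ ENNReal.ofReal (‖μ x - ν x‖ + ‖ν x - ρ x‖) :=
        ENNReal.ofReal_le_ofReal (norm_sub_le_norm_sub_add_norm_sub _ _ _)
    _ ≤ ENNReal.ofReal ‖μ x - ν x‖ + ENNReal.ofReal ‖ν x - ρ x‖ := ENNReal.ofReal_add_le
    _ ≤ _ := add_le_add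
        (le_iSup₂ (f := fun (x : E.toSubmodule) (_ : L x ≤ 1) => ENNReal.ofReal ‖μ x - ν x‖) x hx)
        (le_iSup₂ (f := fun (x : E.toSubmodule) (_ : L x ≤ 1) => ENNReal.ofReal ‖ν x - ρ x‖) x hx)

variable {L}

theorem mongeKantorovich_le_ofReal {μ ν : StateSpace E} {r : ℝ}
    (h : ∀ x, L x ≤ 1 → ‖μ x - ν x‖ ≤ r) : L.mongeKantorovich μ ν ≤ ENNReal.ofReal r :=
  iSup₂_le fun x hx => ENNReal.ofReal_le_ofReal (h x hx)

theorem norm_sub_le_of_mongeKantorovich_le {μ ν : StateSpace E} {r s : ℝ} (hr : 0 ≤ r) (hs : 0 < s)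
    (h : L.mongeKantorovich μ ν ≤ ENNReal.ofReal r) {x : E.toSubmodule} (hx : L x ≤ s) :
    ‖μ x - ν x‖ ≤ s * r := by
  have hs' : ‖((s : ℂ)⁻¹)‖ = s⁻¹ := by
    rw [norm_inv, Complex.norm_real, Real.norm_of_nonneg hs.le]
  have h1 : L ((s : ℂ)⁻¹ • x) ≤ 1 := by
    rw [map_smul_eq_mul, hs', inv_mul_le_iff₀ hs, mul_one]
    exact hx
  have h2 := (le_iSup₂ (f := fun (x : E.toSubmodule) (_ : L x ≤ 1) =>
    ENNReal.ofReal ‖μ x - ν x‖) _ h1).trans h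
  rw [ENNReal.ofReal_le_ofReal_iff hr, map_smul, map_smul, ← smul_sub, norm_smul, hs',
    inv_mul_le_iff₀ hs] at h2
  exact h2

theorem isOpen_metricTopology_ball (μ : StateSpace E) (r : ℝ) :
    @IsOpen _ L.metricTopology {ν | L.mongeKantorovich μ ν < ENNReal.ofReal r} :=
  TopologicalSpace.isOpen_generateFrom_of_mem ⟨μ, r, rfl⟩

variable (L) in
/-- Each `x` is Lipschitz for the metric because `L x` is finite. -/
theorem metricTopology_le_weakStar : L.metricTopology ≤ StateSpace.weakStar E := by
  let := L.metricTopology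
  rw [← continuous_iff_le_induced]
  refine continuous_pi fun x => ?_
  rw [continuous_iff_continuousAt]
  intro μ
  rw [Metric.continuousAt_iff']
  intro ε hε
  have hs : 0 < L x + 1 := by linarith [apply_nonneg L.toSeminorm x]
  have hr : 0 < ε / (2 * (L x + 1)) := by positivity
  have hopen := isOpen_metricTopology_ball (L := L) μ (ε / (2 * (L x + 1)))
  filter_upwards [hopen.mem_nhds (by simpa [mongeKantorovich_self] using hr)] with ν hν
  have h1 := norm_sub_le_of_mongeKantorovich_le hr.le hs (le_of_lt hν) (x := x) (by linarith)
  rw [dist_comm, dist_eq_norm]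
  have h2 : (L x + 1) * (ε / (2 * (L x + 1))) = ε / 2 := by field_simp
  linarith

/-- The state space is convex. -/
theorem _root_.StateSpace.exists_segment (μ ν : StateSpace E) :
    ∃ γ : Set.Icc (0 : ℝ) 1 → StateSpace E,
      ∀ t x, γ t x = μ x + ((t : ℝ) : ℂ) * (ν x - μ x) := by
  have key (t : Set.Icc (0 : ℝ) 1) : ∃ ρ : StateSpace E,
      ∀ x, ρ x = μ x + ((t : ℝ) : ℂ) * (ν x - μ x) := by
    refine ⟨⟨μ.toLinearMap + ((t : ℝ) : ℂ) • (ν.toLinearMap - μ.toLinearMap), ?_, ?_⟩,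
      fun x => rfl⟩
    · have h1 : μ ⟨1, E.one_mem'⟩ = 1 := μ.map_one'
      have h2 : ν ⟨1, E.one_mem'⟩ = 1 := ν.map_one'
      change μ ⟨1, E.one_mem'⟩ + ((t : ℝ) : ℂ) * (ν ⟨1, E.one_mem'⟩ - μ ⟨1, E.one_mem'⟩) = 1
      rw [h1, h2]; ring
    · intro x hx
      have h1 : 0 ≤ μ x := μ.map_nonneg' x hx
      have h2 : 0 ≤ ν x := ν.map_nonneg' x hx
      change 0 ≤ μ x + ((t : ℝ) : ℂ) * (ν x - μ x)
      have h3 : μ x + ((t : ℝ) : ℂ) * (ν x - μ x)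
          = ((1 - t : ℝ) : ℂ) * μ x + ((t : ℝ) : ℂ) * ν x := by push_cast; ring
      rw [h3]
      have h4 : (0 : ℂ) ≤ ((1 - t : ℝ) : ℂ) := by
        rw [Complex.zero_le_real]; linarith [t.2.2]
      have h5 : (0 : ℂ) ≤ ((t : ℝ) : ℂ) := by
        rw [Complex.zero_le_real]; exact t.2.1
      exact add_nonneg (mul_nonneg h4 h1) (mul_nonneg h5 h2)
  exact ⟨fun t => (key t).choose, fun t => (key t).choose_spec⟩

/-- A point near `μ` on the segment from `μ` to `ν` has finite distance from `μ`, and the metric is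
linear along segments. -/
theorem IsCompactQuantumMetric.exists_mongeKantorovich_le (hL : L.IsCompactQuantumMetric)
    (μ ν : StateSpace E) : ∃ r : ℝ, 0 ≤ r ∧ L.mongeKantorovich μ ν ≤ ENNReal.ofReal r := by
  obtain ⟨γ, hγ⟩ := StateSpace.exists_segment μ ν
  have hopen := isOpen_metricTopology_ball (L := L) μ 1
  rw [← hL] at hopen
  let := StateSpace.weakStar E
  have hcont : Continuous γ := by
    rw [continuous_induced_rng]
    refine continuous_pi fun x => ?_
    simp only [Function.comp_def, hγ]
    fun_prop
  have hγ0 : γ 0 ∈ {ν | L.mongeKantorovich μ ν < ENNReal.ofReal 1} := by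
    have : L.mongeKantorovich μ (γ 0) ≤ ENNReal.ofReal 0 :=
      mongeKantorovich_le_ofReal fun x _ => by simp [hγ]
    exact lt_of_le_of_lt this (by simp)
  obtain ⟨t, ht, ht0⟩ : ∃ t : Set.Icc (0 : ℝ) 1,
      γ t ∈ {ν | L.mongeKantorovich μ ν < ENNReal.ofReal 1} ∧ 0 < (t : ℝ) := by
    obtain ⟨ε, hε, hball⟩ := Metric.isOpen_iff.1 (hopen.preimage hcont) 0 hγ0
    refine ⟨⟨min (ε / 2) 1, by positivity, min_le_right _ _⟩, hball ?_, by positivity⟩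
    rw [Metric.mem_ball, Subtype.dist_eq, Real.dist_eq]
    simp only [Set.Icc.coe_zero, sub_zero]
    rw [abs_of_nonneg (by positivity)]
    exact (min_le_left _ _).trans_lt (by linarith)
  refine ⟨(t : ℝ)⁻¹, by positivity, mongeKantorovich_le_ofReal fun x hx => ?_⟩
  have h1 := norm_sub_le_of_mongeKantorovich_le zero_le_one one_pos (le_of_lt ht) hx
  rw [hγ, sub_add_cancel_left, norm_neg, norm_mul, Complex.norm_real, Real.norm_of_nonneg ht0.le,
    one_mul] at h1
  rw [norm_sub_rev, ← mul_one (t : ℝ)⁻¹]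
  rwa [le_inv_mul_iff₀ ht0]

variable [StarOrderedRing A]

/-- If the Lipschitz ball is totally bounded modulo the scalars, the metric topology is the
weak-star topology. -/
theorem isCompactQuantumMetric_of_totallyBounded {T : Set A} (hT : TotallyBounded T)
    (hTE : T ⊆ E.toSubmodule)
    (h : ∀ x : E.toSubmodule, L x ≤ 1 → ∃ c : ℂ, (x : A) - c • (1 : A) ∈ T) :
    L.IsCompactQuantumMetric := by
  refine le_antisymm (le_generateFrom ?_) L.metricTopology_le_weakStar
  rintro _ ⟨μ, r, rfl⟩
  let := StateSpace.weakStar E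
  rw [isOpen_iff_mem_nhds]
  intro ν hν
  obtain ⟨δ, hδ0, hδ⟩ : ∃ δ : ℝ, 0 < δ ∧
      L.mongeKantorovich μ ν + ENNReal.ofReal δ < ENNReal.ofReal r := by
    obtain ⟨δ, hδ0, hδ⟩ := ENNReal.lt_iff_exists_add_pos_lt.1 hν
    exact ⟨δ, hδ0, by simpa using hδ⟩
  obtain ⟨F, hFT, hF, hcover⟩ := Metric.finite_approx_of_totallyBounded hT (δ / 5) (by positivity)
  have hcont (x : E.toSubmodule) : Continuous fun ρ : StateSpace E => ρ x :=
    (continuous_apply x).comp continuous_induced_dom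
  have hnear : ∀ᶠ ρ in nhds ν, ∀ y : F,
      ‖ν ⟨y, hTE (hFT y.2)⟩ - ρ ⟨y, hTE (hFT y.2)⟩‖ < δ / 5 := by
    have := hF.to_subtype
    rw [Filter.eventually_all]
    intro y
    have := (Metric.continuousAt_iff'.1 ((hcont ⟨y, hTE (hFT y.2)⟩).continuousAt (x := ν))) (δ / 5)
      (by positivity)
    simpa only [dist_comm, dist_eq_norm] using this
  filter_upwards [hnear] with ρ hρ
  refine lt_of_le_of_lt ((L.mongeKantorovich_triangle μ ν ρ).trans ?_) hδ
  gcongr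
  refine mongeKantorovich_le_ofReal fun x hx => ?_
  obtain ⟨c, hc⟩ := h x hx
  obtain ⟨y, hy, hxy⟩ := Set.mem_iUnion₂.1 (hcover hc)
  have hyE := hTE (hFT hy)
  let z : E.toSubmodule := x - c • ⟨1, E.one_mem'⟩ - ⟨y, hyE⟩
  have hz : ‖(z : A)‖ < δ / 5 := by
    rwa [Metric.mem_ball, dist_eq_norm] at hxy
  have hstate (ρ : StateSpace E) : ρ x = ρ z + c + ρ ⟨y, hyE⟩ := by
    have h1 : ρ ⟨1, E.one_mem'⟩ = 1 := ρ.map_one'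
    simp only [z, map_sub, map_smul, h1]
    rw [smul_eq_mul, mul_one]
    ring
  have h1 := ν.norm_apply_le z
  have h2 := ρ.norm_apply_le z
  calc ‖ν x - ρ x‖ = ‖(ν z - ρ z) + (ν ⟨y, hyE⟩ - ρ ⟨y, hyE⟩)‖ := by
        rw [hstate ν, hstate ρ]; congr 1; ring
    _ ≤ ‖ν z‖ + ‖ρ z‖ + ‖ν ⟨y, hyE⟩ - ρ ⟨y, hyE⟩‖ :=
        (norm_add_le _ _).trans (by gcongr; exact norm_sub_le _ _)
    _ ≤ δ := by linarith [hρ ⟨y, hy⟩]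

/-- In a compact quantum metric space finitely many small metric balls cover the state space, so the
elements of a Lipschitz ball are determined, up to a small error, by their values on finitely many
states. -/
theorem IsCompactQuantumMetric.totallyBounded (hL : L.IsCompactQuantumMetric) (φ : StateSpace E)
    (c : ℝ) : TotallyBounded {a : A | ∃ x : E.toSubmodule, L x ≤ c ∧ φ x = 0 ∧ (x : A) = a} := by
  wlog hc : 0 < c generalizing c
  · exact (this 1 one_pos).subset (by
      rintro a ⟨x, hx, h⟩
      exact ⟨x, by linarith, h⟩)
  have := φ.nontrivial
  refine Metric.totallyBounded_of_finite_discretization fun ε hε => ?_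
  obtain ⟨δ, hδ, hδε⟩ : ∃ δ : ℝ, 0 < δ ∧ 2 * (2 * (c * δ) + 2 * δ) < ε := by
    refine ⟨ε / (4 * (c + 2)), by positivity, ?_⟩
    have : 2 * (2 * (c * (ε / (4 * (c + 2)))) + 2 * (ε / (4 * (c + 2)))) =
      ε * ((c + 1) / (c + 2)) := by field_simp; ring
    rw [this]
    have : (c + 1) / (c + 2) < 1 := by rw [div_lt_one (by linarith)]; linarith
    nlinarith
  obtain ⟨t, ht⟩ : ∃ t : Finset (StateSpace E),
      Set.univ ⊆ ⋃ μ ∈ t, {ν | L.mongeKantorovich μ ν < ENNReal.ofReal δ} := by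
    refine @IsCompact.elim_finite_subcover _ (StateSpace.weakStar E) _ _
      StateSpace.isCompact_univ_weakStar _ (fun μ => ?_) fun μ _ => ?_
    · rw [hL]; exact isOpen_metricTopology_ball μ δ
    · exact Set.mem_iUnion.2 ⟨μ, by simpa [mongeKantorovich_self] using hδ⟩
  choose R hR0 hR using fun μ => hL.exists_mongeKantorovich_le φ μ
  let Φ (x : E.toSubmodule) : t → ℂ := fun μ => μ.1 x
  let S : Set E.toSubmodule := {x | L x ≤ c ∧ φ x = 0}
  have hbdd : TotallyBounded (Φ '' S) := by
    refine (isCompact_univ_pi fun μ : t =>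
      isCompact_closedBall (0 : ℂ) (c * R μ)).totallyBounded.subset ?_
    rintro _ ⟨x, hx, rfl⟩ μ -
    have := norm_sub_le_of_mongeKantorovich_le (hR0 μ) hc (hR μ) hx.1
    rw [hx.2, zero_sub, norm_neg] at this
    simpa [Φ] using this
  obtain ⟨F, -, hF, hcover⟩ := Metric.finite_approx_of_totallyBounded hbdd δ hδ
  choose x hx using fun a : {a : A | ∃ x : E.toSubmodule, L x ≤ c ∧ φ x = 0 ∧ (x : A) = a} => a.2
  have hcenter (a) : ∃ f : F, dist (Φ (x a)) f < δ := by
    obtain ⟨f, hf, hxf⟩ := Set.mem_iUnion₂.1 (hcover ⟨x a, ⟨(hx a).1, (hx a).2.1⟩, rfl⟩)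
    exact ⟨⟨f, hf⟩, hxf⟩
  choose f hf using hcenter
  refine ⟨F, hF.fintype, f, fun a b hab => ?_⟩
  have hclose (μ : t) : ‖μ.1 (x a) - μ.1 (x b)‖ ≤ 2 * δ := by
    have h1 := dist_triangle_right (Φ (x a)) (Φ (x b)) (f a)
    have h2 := hf a
    have h3 := hf b
    rw [← hab] at h3
    have h4 := dist_le_pi_dist (Φ (x a)) (Φ (x b)) μ
    rw [dist_eq_norm] at h4
    exact h4.trans (by linarith)
  have hall (ν : StateSpace E) : ‖ν (x a - x b)‖ ≤ 2 * (c * δ) + 2 * δ := by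
    obtain ⟨μ, hμ, hμν⟩ := Set.mem_iUnion₂.1 (ht (Set.mem_univ ν))
    have h1 := norm_sub_le_of_mongeKantorovich_le hδ.le hc (le_of_lt hμν) (hx a).1
    have h2 := norm_sub_le_of_mongeKantorovich_le hδ.le hc (le_of_lt hμν) (hx b).1
    have h3 := hclose ⟨μ, hμ⟩
    calc ‖ν (x a - x b)‖
        = ‖-(μ (x a) - ν (x a)) + (μ (x b) - ν (x b)) + (μ (x a) - μ (x b))‖ := by
          rw [map_sub]; congr 1; ring
      _ ≤ ‖μ (x a) - ν (x a)‖ + ‖μ (x b) - ν (x b)‖ + ‖μ (x a) - μ (x b)‖ :=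
          (norm_add₃_le).trans (by rw [norm_neg])
      _ ≤ _ := by linarith
  have := norm_le_of_forall_state hall
  change dist (a : A) b < ε
  rw [← (hx a).2.2, ← (hx b).2.2, dist_eq_norm]
  exact lt_of_le_of_lt this hδε

end SlipNorm

end TotalBoundedness

/-! ### Spectral projections of a circle action -/

section SpectralProjections

open MeasureTheory

variable {A : Type*} [CStarAlgebra A] {σ : Circle →* (A ≃⋆ₐ[ℂ] A)}

theorem continuous_circleExp_zpow (n : ℤ) : Continuous fun t : ℝ => (Circle.exp t : ℂ) ^ n := by
  refine Continuous.zpow₀ ?_ _ fun t => Or.inl (Circle.coe_ne_zero _)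
  simp only [Circle.coe_exp]
  fun_prop

theorem mul_mem_spectralSubspace {m n : ℤ} {a b : A} (ha : a ∈ spectralSubspace σ m)
    (hb : b ∈ spectralSubspace σ n) : a * b ∈ spectralSubspace σ (m + n) := fun z => by
  rw [map_mul, ha z, hb z, smul_mul_smul_comm, zpow_add₀ z.coe_ne_zero]

theorem star_mem_spectralSubspace {n : ℤ} {a : A} (ha : a ∈ spectralSubspace σ n) :
    star a ∈ spectralSubspace σ (-n) := fun z => by
  rw [map_star, ha z, star_smul, star_zpow₀, zpow_neg, ← inv_zpow, ← Circle.coe_inv,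
    Circle.coe_inv_eq_conj, RCLike.star_def]

theorem one_mem_spectralSubspace : (1 : A) ∈ spectralSubspace σ 0 := fun z => by simp

/-- The integrand of the spectral projection, as a power of the circle variable. -/
theorem spectralProj_eq (n : ℤ) (a : A) : spectralProj σ n a =
    ((2 * Real.pi : ℝ)⁻¹ : ℂ) •
      ∫ t in (0 : ℝ)..(2 * Real.pi), ((Circle.exp t : ℂ) ^ (-n)) • σ (Circle.exp t) a := by
  rw [spectralProj]
  congr 1
  refine intervalIntegral.integral_congr fun t _ => ?_
  simp only [Circle.coe_exp, ← Complex.exp_int_mul]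
  congr 2
  push_cast
  ring

theorem IsStronglyContinuous.continuous_integrand (hσ : IsStronglyContinuous σ) (n : ℤ) (a : A) :
    Continuous fun t : ℝ => ((Circle.exp t : ℂ) ^ (-n)) • σ (Circle.exp t) a :=
  (continuous_circleExp_zpow _).smul ((hσ a).comp Circle.exp.continuous)

theorem spectralProj_map (n : ℤ) (L : A →L[ℂ] A) (hσ : IsStronglyContinuous σ) (a : A) :
    L (spectralProj σ n a) = ((2 * Real.pi : ℝ)⁻¹ : ℂ) •
      ∫ t in (0 : ℝ)..(2 * Real.pi), ((Circle.exp t : ℂ) ^ (-n)) • L (σ (Circle.exp t) a) := by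
  rw [spectralProj_eq, map_smul,
    ← L.intervalIntegral_comp_comm ((hσ.continuous_integrand n a).intervalIntegrable _ _)]
  simp only [map_smul]

theorem spectralProj_mem_spectralSubspace (hσ : IsStronglyContinuous σ) (n : ℤ) (a : A) :
    spectralProj σ n a ∈ spectralSubspace σ n := fun z => by
  obtain ⟨s, rfl⟩ := Circle.exp_surjective z
  let S : A →L[ℂ] A :=
    LinearMap.mkContinuous ((σ (Circle.exp s)).toAlgEquiv.toLinearMap) 1 fun b => by
      simpa using NonUnitalStarAlgHom.norm_apply_le (σ (Circle.exp s)) b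
  have hS (b : A) : S b = σ (Circle.exp s) b := rfl
  rw [← hS, spectralProj_map n S hσ, spectralProj_eq, smul_comm]
  congr 1
  have hper : Function.Periodic
      (fun t : ℝ => ((Circle.exp t : ℂ) ^ (-n)) • σ (Circle.exp t) a) (2 * Real.pi) := fun t => by
    simp only [Circle.exp_add_two_pi]
  have hshift := intervalIntegral.integral_comp_add_left (a := 0) (b := 2 * Real.pi)
    (fun t : ℝ => ((Circle.exp t : ℂ) ^ (-n)) • σ (Circle.exp t) a) s
  have hper' := hper.intervalIntegral_add_eq s 0
  rw [zero_add] at hper'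
  rw [add_zero, hper'] at hshift
  rw [← hshift, ← intervalIntegral.integral_smul]
  refine intervalIntegral.integral_congr fun t _ => ?_
  simp only [hS, Circle.exp_add, map_mul, StarAlgEquiv.mul_apply, Circle.coe_mul, smul_smul,
    mul_zpow]
  have hs : (Circle.exp s : ℂ) ^ n * (Circle.exp s : ℂ) ^ (-n) = 1 := by
    rw [zpow_neg, mul_inv_cancel₀ (zpow_ne_zero _ (Circle.coe_ne_zero _))]
  rw [← mul_assoc, hs, one_mul]

theorem spectralProj_mul {m : ℤ} (hσ : IsStronglyContinuous σ) (n : ℤ) (a : A) {b : A}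
    (hb : b ∈ spectralSubspace σ m) :
    spectralProj σ n a * b = spectralProj σ (n + m) (a * b) := by
  have h := spectralProj_map n ((ContinuousLinearMap.mul ℂ A).flip b) hσ a
  simp only [ContinuousLinearMap.flip_apply, ContinuousLinearMap.mul_apply'] at h
  rw [h, spectralProj_eq]
  congr 1
  refine intervalIntegral.integral_congr fun t _ => ?_
  simp only [map_mul, hb _, mul_smul_comm, smul_smul]
  rw [← zpow_add₀ (Circle.coe_ne_zero _)]
  congr 2
  ring

theorem star_spectralProj (hσ : IsStronglyContinuous σ) (n : ℤ) (a : A) :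
    star (spectralProj σ n a) = spectralProj σ (-n) (star a) := by
  rw [spectralProj_eq, spectralProj_eq, star_smul]
  congr 1
  · simp
  · have h := ((starL' ℝ : A ≃L[ℝ] A) : A →L[ℝ] A).intervalIntegral_comp_comm
      ((hσ.continuous_integrand n a).intervalIntegrable (μ := volume) 0 (2 * Real.pi))
    simp only [ContinuousLinearEquiv.coe_coe, starL'_apply] at h
    rw [← h]
    refine intervalIntegral.integral_congr fun t _ => ?_
    simp only [star_smul, map_star, star_zpow₀]
    rw [RCLike.star_def, ← Circle.coe_inv_eq_conj, Circle.coe_inv, inv_zpow, ← zpow_neg]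

theorem spectralProj_zero_sub_smul_one (hσ : IsStronglyContinuous σ) (a : A) (c : ℂ) :
    spectralProj σ 0 (a - c • 1) = spectralProj σ 0 a - c • 1 := by
  have hπ : (2 * Real.pi : ℂ) ≠ 0 := by simp [Real.pi_ne_zero]
  have hint := (hσ.continuous_integrand 0 a).intervalIntegrable (μ := volume) 0 (2 * Real.pi)
  simp only [neg_zero, zpow_zero, one_smul] at hint
  simp only [spectralProj_eq, map_sub, map_smul, map_one, neg_zero, zpow_zero, one_smul]
  rw [intervalIntegral.integral_sub hint intervalIntegrable_const, smul_sub,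
    intervalIntegral.integral_const, sub_zero, ← Complex.coe_smul, smul_smul]
  push_cast
  rw [inv_mul_cancel₀ hπ, one_smul]

theorem norm_sub_le_circleSlip_mul {a : A} (ha : a ∈ circleLip σ) (z : Circle) :
    ‖σ z a - a‖ ≤ circleSlip σ a * circleLength z := by
  rcases eq_or_ne z 1 with rfl | hz
  · simp [circleLength]
  · have hpos : 0 < circleLength z := by
      rw [circleLength, abs_pos, Ne, Circle.arg_eq_zero]
      exact hz
    have h : circleQuotient σ a ⟨z, hz⟩ ≤ circleSlip σ a := le_ciSup ha ⟨z, hz⟩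
    rwa [circleQuotient, div_le_iff₀ hpos] at h

theorem circleSlip_nonneg (a : A) : 0 ≤ circleSlip σ a :=
  Real.iSup_nonneg fun _ => div_nonneg (norm_nonneg _) (abs_nonneg _)

theorem circleLength_le_pi (z : Circle) : circleLength z ≤ Real.pi := Complex.abs_arg_le_pi _

/-- For `n ≠ 0` the scalar `∫ e^{-int} dt` vanishes, so `a` may be subtracted in the integrand. -/
theorem norm_spectralProj_le (hσ : IsStronglyContinuous σ) {n : ℤ} (hn : n ≠ 0) {a : A}
    (ha : a ∈ circleLip σ) : ‖spectralProj σ n a‖ ≤ Real.pi * circleSlip σ a := by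
  have hχ : Continuous fun t : ℝ => (Circle.exp t : ℂ) ^ (-n) := continuous_circleExp_zpow _
  have hzero : ∫ t in (0 : ℝ)..(2 * Real.pi), (Circle.exp t : ℂ) ^ (-n) = 0 := by
    have hc : (-n * Complex.I : ℂ) ≠ 0 := by simp [hn]
    have h1 : ∀ t : ℝ, (Circle.exp t : ℂ) ^ (-n) = Complex.exp ((-n * Complex.I : ℂ) * t) := by
      intro t
      rw [Circle.coe_exp, ← Complex.exp_int_mul]
      congr 1
      push_cast
      ring
    simp only [h1]
    rw [integral_exp_mul_complex hc]
    have h2 : (-n * Complex.I : ℂ) * ((2 * Real.pi : ℝ) : ℂ)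
        = ((-n : ℤ) : ℂ) * (2 * Real.pi * Complex.I) := by push_cast; ring
    rw [h2, Complex.exp_int_mul_two_pi_mul_I]
    simp
  have heq : spectralProj σ n a = ((2 * Real.pi : ℝ)⁻¹ : ℂ) •
      ∫ t in (0 : ℝ)..(2 * Real.pi),
        ((Circle.exp t : ℂ) ^ (-n)) • (σ (Circle.exp t) a - a) := by
    rw [spectralProj_eq]
    simp only [smul_sub]
    have hint : IntervalIntegrable (fun t : ℝ => ((Circle.exp t : ℂ) ^ (-n)) • a) volume 0
        (2 * Real.pi) := (hχ.smul continuous_const).intervalIntegrable _ _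
    rw [intervalIntegral.integral_sub ((hσ.continuous_integrand n a).intervalIntegrable _ _)
      hint, intervalIntegral.integral_smul_const,
      hzero, zero_smul, sub_zero]
  have hbound := intervalIntegral.norm_integral_le_of_norm_le_const (a := 0) (b := 2 * Real.pi)
    (C := Real.pi * circleSlip σ a)
    (f := fun t : ℝ => ((Circle.exp t : ℂ) ^ (-n)) • (σ (Circle.exp t) a - a)) (fun t _ => by
      rw [norm_smul, norm_zpow, Circle.norm_coe, one_zpow, one_mul, mul_comm]
      exact (norm_sub_le_circleSlip_mul ha _).trans
        (mul_le_mul_of_nonneg_left (circleLength_le_pi _) (circleSlip_nonneg a)))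
  rw [sub_zero, abs_of_pos Real.two_pi_pos] at hbound
  rw [heq, norm_smul, norm_inv, Complex.norm_real, Real.norm_of_nonneg Real.two_pi_pos.le,
    inv_mul_le_iff₀ Real.two_pi_pos, mul_comm (2 * Real.pi)]
  exact hbound

/-- A lower semicontinuous seminorm does not increase under averaging: its balls are convex and
closed in `E`. The average is assumed to stay in `E`, which need not be closed. -/
theorem SlipNorm.IsLSC.average_le {E : OperatorSystem A} {p : SlipNorm E} (hp : p.IsLSC)
    {f : ℝ → A} (hf : Continuous f) {c : ℝ}
    (hfc : ∀ t, ∃ h : f t ∈ E.toSubmodule, p ⟨f t, h⟩ ≤ c)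
    (hmem : ((2 * Real.pi : ℝ)⁻¹ : ℂ) • ∫ t in (0 : ℝ)..(2 * Real.pi), f t ∈ E.toSubmodule) :
    p ⟨_, hmem⟩ ≤ c := by
  let K : Set A := (↑) '' {x : E.toSubmodule | p x ≤ c}
  have hK : Convex ℝ K := by
    rintro _ ⟨x, hx, rfl⟩ _ ⟨y, hy, rfl⟩ s t hs ht hst
    refine ⟨(s : ℂ) • x + (t : ℂ) • y, ?_, by simp⟩
    have hx' : p x ≤ c := hx
    have hy' : p y ≤ c := hy
    change p ((s : ℂ) • x + (t : ℂ) • y) ≤ c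
    calc p ((s : ℂ) • x + (t : ℂ) • y) ≤ p ((s : ℂ) • x) + p ((t : ℂ) • y) :=
          map_add_le_add p.toSeminorm _ _
      _ = s * p x + t * p y := by
          rw [map_smul_eq_mul, map_smul_eq_mul, Complex.norm_real, Complex.norm_real,
            Real.norm_of_nonneg hs, Real.norm_of_nonneg ht]
      _ ≤ s * c + t * c := by gcongr
      _ = c := by rw [← add_mul, hst, one_mul]
  have hvol : volume (Set.uIoc 0 (2 * Real.pi)) ≠ 0 := by
    rw [Set.uIoc_of_le Real.two_pi_pos.le, Real.volume_Ioc]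
    simpa using Real.pi_pos
  have hmemK : (⨍ t in (0 : ℝ)..(2 * Real.pi), f t) ∈ closure K := by
    refine hK.set_average_mem_closure hvol ?_ (ae_of_all _ fun t => ?_) ?_
    · rw [Set.uIoc_of_le Real.two_pi_pos.le, Real.volume_Ioc]; exact ENNReal.ofReal_ne_top
    · obtain ⟨h, hc⟩ := hfc t
      exact ⟨⟨f t, h⟩, hc, rfl⟩
    · exact intervalIntegrable_iff.1 (hf.intervalIntegrable _ _)
  rw [interval_average_eq, sub_zero, ← Complex.coe_smul] at hmemK
  have hclosed : IsClosed {x : E.toSubmodule | p x ≤ c} := hp.isClosed_preimage c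
  have h2 : (⟨_, hmem⟩ : E.toSubmodule) ∈ closure {x : E.toSubmodule | p x ≤ c} := by
    rw [closure_subtype]
    convert hmemK using 1
    push_cast
    rfl
  rw [hclosed.closure_eq] at h2
  exact h2

end SpectralProjections

/-! ### Approximation by finite sums of spectral projections -/

section Approximation

open MeasureTheory

/-- The powers of `(1 + cos t) / 2` concentrate at `t = 0`. -/
theorem exists_integral_pow_mul_abs_le {ε : ℝ} (hε : 0 < ε) : ∃ N : ℕ,
    0 < ∫ t in -Real.pi..Real.pi, ((1 + Real.cos t) / 2) ^ N ∧
    ∫ t in -Real.pi..Real.pi, ((1 + Real.cos t) / 2) ^ N * |t| ≤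
      ε * ∫ t in -Real.pi..Real.pi, ((1 + Real.cos t) / 2) ^ N := by
  have hc0 (t : ℝ) : 0 ≤ (1 + Real.cos t) / 2 := by linarith [Real.neg_one_le_cos t]
  have hlim := tendsto_setIntegral_pow_smul_of_unique_maximum_of_isCompact_of_continuousOn
    (μ := volume) (s := Set.Icc (-Real.pi) Real.pi) isCompact_Icc (x₀ := 0)
    (c := fun t => (1 + Real.cos t) / 2) (g := fun t : ℝ => |t|) (by fun_prop)
    (fun t ht ht0 => by
      have h1 : Real.cos t ≠ 1 := by
        rw [Ne, Real.cos_eq_one_iff_of_lt_of_lt (by linarith [ht.1, Real.pi_pos])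
          (by linarith [ht.2, Real.pi_pos])]
        exact ht0
      have h2 := lt_of_le_of_ne (Real.cos_le_one t) h1
      simp only [Real.cos_zero]
      linarith)
    (fun t _ => hc0 t) (by simp)
    (by rw [interior_Icc, closure_Ioo (by linarith [Real.pi_pos])]; simp [Real.pi_pos.le])
    (by fun_prop)
  simp only [abs_zero, smul_eq_mul] at hlim
  obtain ⟨N, hN⟩ := (hlim.eventually (gt_mem_nhds hε)).exists
  have hpos : 0 < ∫ t in -Real.pi..Real.pi, ((1 + Real.cos t) / 2) ^ N := by
    refine intervalIntegral.intervalIntegral_pos_of_pos_on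
      (Continuous.intervalIntegrable (by fun_prop) _ _) (fun t ht => ?_) (by linarith [Real.pi_pos])
    have h1 : -1 < Real.cos t := by
      refine lt_of_le_of_ne (Real.neg_one_le_cos t) fun h => ?_
      have h2 : Real.cos |t| = Real.cos Real.pi := by rw [Real.cos_abs, ← h, Real.cos_pi]
      have h3 := Real.injOn_cos ⟨abs_nonneg t, (abs_lt.2 ht).le⟩ ⟨Real.pi_pos.le, le_rfl⟩ h2
      exact (abs_lt.2 ht).ne h3
    exact pow_pos (by linarith) N
  refine ⟨N, hpos, ?_⟩
  rw [integral_Icc_eq_integral_Ioc, integral_Icc_eq_integral_Ioc,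
    ← intervalIntegral.integral_of_le (by linarith [Real.pi_pos]),
    ← intervalIntegral.integral_of_le (by linarith [Real.pi_pos])] at hN
  rw [inv_mul_lt_iff₀ hpos, mul_comm] at hN
  exact hN.le

/-- The binomial expansion of `((1 + cos t) / 2) ^ N = e^{-iNt} (1 + e^{it})^{2N} / 4 ^ N`. -/
theorem ofReal_one_add_cos_div_two_pow (N : ℕ) (t : ℝ) :
    (((1 + Real.cos t) / 2) ^ N : ℝ) = ∑ j ∈ Finset.range (2 * N + 1),
      (((2 * N).choose j : ℂ) / 4 ^ N) * (Circle.exp t : ℂ) ^ (-((N : ℤ) - j)) := by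
  have hz : (Circle.exp t : ℂ) ≠ 0 := Circle.coe_ne_zero _
  have hcos : (Real.cos t : ℂ) = ((Circle.exp t : ℂ) + (Circle.exp t : ℂ)⁻¹) / 2 := by
    rw [Complex.ofReal_cos, Complex.cos, Circle.coe_exp, ← Complex.exp_neg, neg_mul]
  rw [Complex.ofReal_pow, Complex.ofReal_div, Complex.ofReal_add, hcos, Complex.ofReal_one,
    Complex.ofReal_ofNat]
  generalize (Circle.exp t : ℂ) = z at hz
  have h1 : (1 + (z + z⁻¹) / 2) / 2 = z⁻¹ * (z + 1) ^ 2 / 4 := by field_simp; ring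
  rw [h1, div_pow, mul_pow, ← pow_mul, add_pow, Finset.mul_sum, Finset.sum_div]
  refine Finset.sum_congr rfl fun j _ => ?_
  rw [neg_sub, zpow_sub₀ hz, zpow_natCast, zpow_natCast, inv_pow]
  simp only [one_pow, mul_one]
  field_simp

variable {A : Type*} [CStarAlgebra A] {σ : Circle →* (A ≃⋆ₐ[ℂ] A)}

/-- Lipschitz elements are approximated by finite combinations of their spectral projections,
with an error that depends on the element only through its Lipschitz constant. -/
theorem exists_norm_sub_sum_spectralProj_le (hσ : IsStronglyContinuous σ) {ε : ℝ} (hε : 0 < ε) :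
    ∃ (m : ℕ) (c : ℕ → ℂ) (n : ℕ → ℤ), ∀ a ∈ circleLip σ,
      ‖a - ∑ j ∈ Finset.range m, c j • spectralProj σ (n j) a‖ ≤ ε * circleSlip σ a := by
  obtain ⟨N, hpos, hN⟩ := exists_integral_pow_mul_abs_le hε
  set k : ℝ → ℝ := fun t => ((1 + Real.cos t) / 2) ^ N with hk
  set K : ℝ := ∫ t in -Real.pi..Real.pi, k t with hK
  have hkc : Continuous k := by fun_prop
  have hk0 (t : ℝ) : 0 ≤ k t := pow_nonneg (by linarith [Real.neg_one_le_cos t]) N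
  have hKC : (K : ℂ) ≠ 0 := by exact_mod_cast hpos.ne'
  refine ⟨2 * N + 1,
    fun j => (K : ℂ)⁻¹ * ((2 * Real.pi : ℝ) : ℂ) * (((2 * N).choose j : ℂ) / 4 ^ N),
    fun j => (N : ℤ) - j, fun a ha => ?_⟩
  have hσc : Continuous fun t : ℝ => σ (Circle.exp t) a := (hσ a).comp Circle.exp.continuous
  have hper : Function.Periodic (fun t : ℝ => (k t : ℂ) • σ (Circle.exp t) a) (2 * Real.pi) :=
    fun t => by simp only [hk, Circle.exp_add_two_pi, Real.cos_add_two_pi]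
  have hsum : ∑ j ∈ Finset.range (2 * N + 1),
      ((K : ℂ)⁻¹ * ((2 * Real.pi : ℝ) : ℂ) * (((2 * N).choose j : ℂ) / 4 ^ N)) •
        spectralProj σ ((N : ℤ) - j) a
      = (K : ℂ)⁻¹ • ∫ t in -Real.pi..Real.pi, (k t : ℂ) • σ (Circle.exp t) a := by
    have h1 := hper.intervalIntegral_add_eq (-Real.pi) 0
    rw [zero_add, show -Real.pi + 2 * Real.pi = Real.pi by ring] at h1
    rw [h1]
    simp only [hk, ofReal_one_add_cos_div_two_pow, Finset.sum_smul, mul_smul]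
    have hint (j : ℕ) : IntervalIntegrable (fun t : ℝ => (((2 * N).choose j : ℂ) / 4 ^ N) •
        ((Circle.exp t : ℂ) ^ (-((N : ℤ) - j))) • σ (Circle.exp t) a) volume 0 (2 * Real.pi) :=
      ((hσ.continuous_integrand _ a).const_smul _).intervalIntegrable _ _
    rw [intervalIntegral.integral_finsetSum fun j _ => hint j, Finset.smul_sum]
    refine Finset.sum_congr rfl fun j _ => ?_
    have hπ : ((2 * Real.pi : ℝ) : ℂ) ≠ 0 := by exact_mod_cast Real.two_pi_pos.ne'
    rw [spectralProj_eq, intervalIntegral.integral_smul]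
    congr 1
    rw [smul_comm (((2 * N).choose j : ℂ) / 4 ^ N), smul_smul, mul_inv_cancel₀ hπ, one_smul]
  have ha' : a = (K : ℂ)⁻¹ • ∫ t in -Real.pi..Real.pi, (k t : ℂ) • a := by
    rw [intervalIntegral.integral_smul_const, intervalIntegral.integral_ofReal, smul_smul,
      inv_mul_cancel₀ hKC, one_smul]
  have hint1 : IntervalIntegrable (fun t : ℝ => (k t : ℂ) • a) volume (-Real.pi) Real.pi :=
    ((Complex.continuous_ofReal.comp hkc).smul continuous_const).intervalIntegrable _ _
  have hint2 : IntervalIntegrable (fun t : ℝ => (k t : ℂ) • σ (Circle.exp t) a) volume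
      (-Real.pi) Real.pi :=
    ((Complex.continuous_ofReal.comp hkc).smul hσc).intervalIntegrable _ _
  rw [hsum]
  calc ‖a - (K : ℂ)⁻¹ • ∫ t in -Real.pi..Real.pi, (k t : ℂ) • σ (Circle.exp t) a‖
      = K⁻¹ * ‖∫ t in -Real.pi..Real.pi, ((k t : ℂ) • a - (k t : ℂ) • σ (Circle.exp t) a)‖ := by
        rw [intervalIntegral.integral_sub hint1 hint2, ← abs_of_pos (inv_pos.2 hpos),
          ← Real.norm_eq_abs, ← Complex.norm_real, ← norm_smul, smul_sub, Complex.ofReal_inv, ← ha']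
    _ ≤ K⁻¹ * ∫ t in -Real.pi..Real.pi, circleSlip σ a * (k t * |t|) := by
        gcongr
        refine intervalIntegral.norm_integral_le_of_norm_le (by linarith [Real.pi_pos])
          (ae_of_all _ fun t ht => ?_) (Continuous.intervalIntegrable (by fun_prop) _ _)
        have h1 := norm_sub_le_circleSlip_mul ha (Circle.exp t)
        rw [circleLength, Circle.arg_exp ht.1 ht.2] at h1
        rw [← smul_sub, norm_smul, Complex.norm_real, Real.norm_of_nonneg (hk0 t), norm_sub_rev]
        calc k t * ‖σ (Circle.exp t) a - a‖ ≤ k t * (circleSlip σ a * |t|) := by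
              gcongr; exact hk0 t
          _ = _ := by ring
    _ ≤ K⁻¹ * (circleSlip σ a * (ε * K)) := by
        rw [intervalIntegral.integral_const_mul]
        gcongr
        exact circleSlip_nonneg a
    _ = ε * circleSlip σ a := by field_simp

end Approximation

/-! ### Total boundedness of sums -/

theorem totallyBounded_image_sum {V : Type*} [NormedAddCommGroup V] [CompleteSpace V]
    {ι : Type*} [Fintype ι] {T : ι → Set V} (hT : ∀ j, TotallyBounded (T j)) {g : ι → V → V}
    (hg : ∀ j, Continuous (g j)) :
    TotallyBounded ((fun w : ι → V => ∑ j, g j (w j)) '' Set.univ.pi T) := by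
  have hcomp : IsCompact (Set.univ.pi fun j => closure (T j)) :=
    isCompact_univ_pi fun j => (hT j).closure.isCompact_of_isClosed isClosed_closure
  have hcont : Continuous fun w : ι → V => ∑ j, g j (w j) :=
    continuous_finsetSum _ fun j _ => (hg j).comp (continuous_apply j)
  exact (hcomp.image hcont).totallyBounded.subset
    (Set.image_mono (Set.pi_mono fun j _ => subset_closure))

theorem SlipNorm.IsCompactQuantumMetric.totallyBounded_of_norm_le {A : Type*} [CStarAlgebra A]
    [PartialOrder A] [StarOrderedRing A] {E : OperatorSystem A} {L : SlipNorm E}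
    (hL : L.IsCompactQuantumMetric) (φ : StateSpace E) (c r : ℝ) :
    TotallyBounded {a : A | ∃ x : E.toSubmodule, L x ≤ c ∧ ‖(x : A)‖ ≤ r ∧ (x : A) = a} := by
  have h1 := (hL.totallyBounded φ c).closure.isCompact_of_isClosed isClosed_closure
  have h2 : IsCompact ((fun z : ℂ => z • (1 : A)) '' Metric.closedBall 0 (2 * r)) :=
    (isCompact_closedBall _ _).image (by fun_prop)
  refine (h1.add h2).totallyBounded.subset ?_
  rintro _ ⟨x, hx, hr, rfl⟩
  have hφ1 : φ ⟨1, E.one_mem'⟩ = 1 := φ.map_one'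
  refine Set.mem_add.2 ⟨((x - φ x • ⟨1, E.one_mem'⟩ : E.toSubmodule) : A),
    subset_closure ⟨_, ?_, ?_, rfl⟩, φ x • 1, ⟨φ x, ?_, rfl⟩, by simp⟩
  · have h1 : L ⟨1, E.one_mem'⟩ = 0 := L.map_one'
    calc L (x - φ x • ⟨1, E.one_mem'⟩) ≤ L x + L (φ x • ⟨1, E.one_mem'⟩) :=
          map_sub_le_add L.toSeminorm _ _
      _ ≤ c := by rw [map_smul_eq_mul, h1, mul_zero, add_zero]; exact hx
  · rw [map_sub, map_smul, hφ1, smul_eq_mul, mul_one, sub_self]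
  · rw [mem_closedBall_zero_iff]
    exact (φ.norm_apply_le x).trans (by linarith)

/-! ### Spectral subspaces as finite modules over the fixed point algebra -/

section SpectralSubspaces

variable {A : Type*} [CStarAlgebra A] {B : Type*} [CStarAlgebra B]
  {σ : Circle →* (A ≃⋆ₐ[ℂ] A)} {𝒜 : StarSubalgebra ℂ A}

theorem isClosed_fixedPointAlgebra (σ : Circle →* (A ≃⋆ₐ[ℂ] A)) :
    IsClosed (fixedPointAlgebra σ : Set A) := by
  have : (fixedPointAlgebra σ : Set A) = ⋂ z, {a | σ z a = a} := by
    ext a; simp [fixedPointAlgebra]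
  rw [this]
  refine isClosed_iInter fun z => isClosed_eq ?_ continuous_id
  exact (StarAlgEquiv.isometry (σ z)).continuous

/-- Products of the elements of a partition of unity in `A_d` are partitions of unity in the
subspaces `A_{nd}`. -/
theorem exists_sum_star_mul_self_eq_one {d : ℤ}
    (h : ∃ (m : ℕ) (ζ : Fin m → A), (∀ j, ζ j ∈ 𝒜 ∧ ζ j ∈ spectralSubspace σ d) ∧
      ∑ j, star (ζ j) * ζ j = 1) (n : ℕ) :
    ∃ (ι : Type) (_ : Fintype ι) (ξ : ι → A),
      (∀ j, ξ j ∈ 𝒜 ∧ ξ j ∈ spectralSubspace σ (n * d)) ∧ ∑ j, star (ξ j) * ξ j = 1 := by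
  obtain ⟨m, ζ, hζ, hζ1⟩ := h
  induction n with
  | zero =>
    refine ⟨Unit, inferInstance, fun _ => 1, fun _ => ⟨one_mem _, ?_⟩, by simp⟩
    simpa using one_mem_spectralSubspace (σ := σ)
  | succ n ih =>
    obtain ⟨ι, _, ξ, hξ, hξ1⟩ := ih
    refine ⟨ι × Fin m, inferInstance, fun j => ζ j.2 * ξ j.1, fun j =>
      ⟨mul_mem (hζ _).1 (hξ _).1, ?_⟩, ?_⟩
    · have := mul_mem_spectralSubspace (hζ j.2).2 (hξ j.1).2
      rwa [show d + n * d = ((n + 1 : ℕ) : ℤ) * d by push_cast; ring] at this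
    · rw [Fintype.sum_prod_type, ← hξ1]
      refine Finset.sum_congr rfl fun i _ => ?_
      have h1 (j : Fin m) : star (ζ j * ξ i) * (ζ j * ξ i)
          = star (ξ i) * (star (ζ j) * ζ j) * ξ i := by
        rw [star_mul]; simp only [mul_assoc]
      simp only [h1]
      rw [← Finset.sum_mul, ← Finset.mul_sum, hζ1, mul_one]

/-- Although `β` need not be bounded on `𝒜`, it is bounded on each spectral subspace: there it is
controlled by its restriction to the fixed points, where it is contractive. -/
theorem exists_norm_map_le_of_mem_spectralSubspace (β : 𝒜 →ₐ[ℂ] B)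
    (hext : ∃ β₀ : fixedPointAlgebra σ →⋆ₐ[ℂ] B,
      ∀ (a : A) (ha : a ∈ 𝒜) (ha₀ : a ∈ fixedPointAlgebra σ), β₀ ⟨a, ha₀⟩ = β ⟨a, ha⟩)
    {k : ℤ} {ι : Type} [Fintype ι] {ξ : ι → A}
    (hξ : ∀ j, ξ j ∈ 𝒜 ∧ ξ j ∈ spectralSubspace σ k) (hξ1 : ∑ j, star (ξ j) * ξ j = 1) :
    ∃ D : ℝ, 0 ≤ D ∧ ∀ (a : A) (ha : a ∈ 𝒜), a ∈ spectralSubspace σ k →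
      ‖β ⟨a, ha⟩‖ ≤ D * ‖a‖ := by
  obtain ⟨β₀, hβ₀⟩ := hext
  have := isClosed_fixedPointAlgebra σ
  have hcontr (a : A) (ha : a ∈ 𝒜) (ha₀ : a ∈ fixedPointAlgebra σ) : ‖β ⟨a, ha⟩‖ ≤ ‖a‖ := by
    rw [← hβ₀ a ha ha₀]
    exact NonUnitalStarAlgHom.norm_apply_le β₀ ⟨a, ha₀⟩
  refine ⟨∑ j, ‖ξ j‖ * ‖β ⟨ξ j, (hξ j).1⟩‖, by positivity, fun a ha hak => ?_⟩
  have hmem (j : ι) : a * star (ξ j) ∈ 𝒜 := mul_mem ha (star_mem (hξ j).1)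
  have hfix (j : ι) : a * star (ξ j) ∈ fixedPointAlgebra σ := by
    have := mul_mem_spectralSubspace hak (star_mem_spectralSubspace (hξ j).2)
    rw [add_neg_cancel] at this
    exact (mem_fixedPointAlgebra_iff σ _).2 this
  have hdecomp : (⟨a, ha⟩ : 𝒜) = ∑ j, ⟨a * star (ξ j), hmem j⟩ * ⟨ξ j, (hξ j).1⟩ := by
    refine Subtype.ext ?_
    rw [AddSubmonoidClass.coe_finsetSum]
    simp only [MulMemClass.mk_mul_mk, mul_assoc]
    rw [← Finset.mul_sum, hξ1, mul_one]
  rw [hdecomp, map_sum, Finset.sum_mul]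
  refine norm_sum_le_of_le _ fun j _ => ?_
  rw [map_mul]
  calc ‖β ⟨a * star (ξ j), hmem j⟩ * β ⟨ξ j, (hξ j).1⟩‖
      ≤ ‖β ⟨a * star (ξ j), hmem j⟩‖ * ‖β ⟨ξ j, (hξ j).1⟩‖ := norm_mul_le _ _
    _ ≤ (‖a‖ * ‖ξ j‖) * ‖β ⟨ξ j, (hξ j).1⟩‖ := by
        gcongr
        refine (hcontr _ _ (hfix j)).trans ((norm_mul_le _ _).trans_eq ?_)
        rw [norm_star]
    _ = _ := by ring

theorem spectralProj_mem_of_sum_eq_one (hσ : IsStronglyContinuous σ)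
    (hP : ∀ a ∈ 𝒜, spectralProj σ 0 a ∈ 𝒜) {k : ℤ} {ι : Type} [Fintype ι] {ξ : ι → A}
    (hξ : ∀ j, ξ j ∈ 𝒜 ∧ ξ j ∈ spectralSubspace σ k) (hξ1 : ∑ j, star (ξ j) * ξ j = 1)
    {a : A} (ha : a ∈ 𝒜) : spectralProj σ k a ∈ 𝒜 := by
  have : spectralProj σ k a = ∑ j, spectralProj σ 0 (a * star (ξ j)) * ξ j := by
    have h1 (j : ι) : spectralProj σ 0 (a * star (ξ j)) = spectralProj σ k a * star (ξ j) := by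
      rw [spectralProj_mul hσ k a (star_mem_spectralSubspace (hξ j).2), add_neg_cancel]
    simp only [h1, mul_assoc]
    rw [← Finset.mul_sum, hξ1, mul_one]
  rw [this]
  exact sum_mem fun j _ => mul_mem (hP _ (mul_mem ha (star_mem (hξ j).1))) (hξ j).1

theorem SlipNorm.IsLSC.apply_spectralProj_le (hσ : IsStronglyContinuous σ)
    {p : SlipNorm (OperatorSystem.ofStarSubalgebra 𝒜)} (hp : p.IsLSC)
    (hinv : ∀ (z : Circle) (a : A), a ∈ 𝒜 → σ z a ∈ 𝒜)
    (hpinv : ∀ (z : Circle) (a : A) (ha : a ∈ 𝒜), p ⟨σ z a, hinv z a ha⟩ = p ⟨a, ha⟩)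
    (n : ℤ) {a : A} (ha : a ∈ 𝒜) (hn : spectralProj σ n a ∈ 𝒜) :
    p ⟨spectralProj σ n a, hn⟩ ≤ p ⟨a, ha⟩ := by
  have h := hp.average_le (hσ.continuous_integrand n a) (c := p ⟨a, ha⟩) (fun t => by
    refine ⟨(OperatorSystem.ofStarSubalgebra 𝒜).toSubmodule.smul_mem _
      (hinv (Circle.exp t) a ha), ?_⟩
    have h1 := map_smul_eq_mul p.toSeminorm ((Circle.exp t : ℂ) ^ (-n))
      ⟨σ (Circle.exp t) a, hinv (Circle.exp t) a ha⟩
    rw [norm_zpow, Circle.norm_coe, one_zpow, one_mul, hpinv _ a ha] at h1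
    exact h1.le) (by rw [← spectralProj_eq]; exact hn)
  simpa only [← spectralProj_eq] using h

end SpectralSubspaces

/-! ### Lipschitz balls of the circle action -/

section LipschitzBalls

variable {A : Type*} [CStarAlgebra A] [PartialOrder A] [StarOrderedRing A]
  {B : Type*} [CStarAlgebra B] {σ : Circle →* (A ≃⋆ₐ[ℂ] A)} {𝒜 : StarSubalgebra ℂ A}

/-- Multiplication by the partition of unity moves `P_n a` into the fixed point algebra, where the
twisted Leibniz rule bounds the slip-norm because `β` is bounded on spectral subspaces. -/
theorem totallyBounded_image_spectralProj (hσ : IsStronglyContinuous σ) (β : 𝒜 →ₐ[ℂ] B)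
    (Lβ : SlipNorm (OperatorSystem.ofStarSubalgebra 𝒜))
    (hinv : ∀ (z : Circle) (a : A), a ∈ 𝒜 → σ z a ∈ 𝒜)
    (hP : ∀ a ∈ 𝒜, spectralProj σ 0 a ∈ 𝒜)
    (hleib : ∀ a b : 𝒜, Lβ ⟨a * b, (a * b).2⟩ ≤
      Lβ ⟨a, a.2⟩ * ‖β b‖ + ‖conjTwist β a‖ * Lβ ⟨b, b.2⟩)
    (hext : ∃ β₀ : fixedPointAlgebra σ →⋆ₐ[ℂ] B,
      ∀ (a : A) (ha : a ∈ 𝒜) (ha₀ : a ∈ fixedPointAlgebra σ), β₀ ⟨a, ha₀⟩ = β ⟨a, ha⟩)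
    (hlsc : Lβ.IsLSC)
    (hLβinv : ∀ (z : Circle) (a : A) (ha : a ∈ 𝒜), Lβ ⟨σ z a, hinv z a ha⟩ = Lβ ⟨a, ha⟩)
    (hcqms : (Lβ.restrict (F := OperatorSystem.ofStarSubalgebra (𝒜 ⊓ fixedPointAlgebra σ))
      (fun _ hx => hx.1)).IsCompactQuantumMetric)
    (φ : StateSpace (OperatorSystem.ofStarSubalgebra (𝒜 ⊓ fixedPointAlgebra σ)))
    {k : ℤ} (hk : k ≠ 0)
    (hpos : ∃ (ι : Type) (_ : Fintype ι) (ξ : ι → A),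
      (∀ j, ξ j ∈ 𝒜 ∧ ξ j ∈ spectralSubspace σ k) ∧ ∑ j, star (ξ j) * ξ j = 1)
    (hneg : ∃ (ι : Type) (_ : Fintype ι) (ξ : ι → A),
      (∀ j, ξ j ∈ 𝒜 ∧ ξ j ∈ spectralSubspace σ (-k)) ∧ ∑ j, star (ξ j) * ξ j = 1)
    {C : ℝ} {V : Set A}
    (hV : ∀ a ∈ V, ∃ ha : a ∈ 𝒜, a ∈ circleLip σ ∧ circleSlip σ a ≤ C ∧ Lβ ⟨a, ha⟩ ≤ C) :
    TotallyBounded (spectralProj σ k '' V) := by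
  obtain ⟨ι, _, ξ, hξ, hξ1⟩ := hpos
  obtain ⟨ι', _, ξ', hξ', hξ1'⟩ := hneg
  obtain ⟨D, hD, hβ⟩ := exists_norm_map_le_of_mem_spectralSubspace β hext hξ' hξ1'
  let η (j : ι) : 𝒜 := ⟨star (ξ j), star_mem (hξ j).1⟩
  have hTB (j : ι) := hcqms.totallyBounded_of_norm_le φ
    (C * ‖β (η j)‖ + (D * (Real.pi * C)) * Lβ ⟨η j, (η j).2⟩) (Real.pi * C * ‖ξ j‖)
  refine (totallyBounded_image_sum hTB (g := fun j y => y * ξ j) (by fun_prop)).subset ?_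
  rintro _ ⟨a, haV, rfl⟩
  obtain ⟨ha, halip, haC, haβ⟩ := hV a haV
  have hpmem : spectralProj σ k a ∈ 𝒜 := spectralProj_mem_of_sum_eq_one hσ hP hξ hξ1 ha
  have hpk := spectralProj_mem_spectralSubspace hσ k a
  have hpnorm : ‖spectralProj σ k a‖ ≤ Real.pi * C :=
    (norm_spectralProj_le hσ hk halip).trans (by gcongr)
  have hpβ : Lβ ⟨_, hpmem⟩ ≤ C := (hlsc.apply_spectralProj_le hσ hinv hLβinv k ha hpmem).trans haβ
  refine ⟨fun j => spectralProj σ k a * star (ξ j), fun j _ => ?_, ?_⟩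
  · have hfix : spectralProj σ k a * star (ξ j) ∈ fixedPointAlgebra σ := by
      have := mul_mem_spectralSubspace hpk (star_mem_spectralSubspace (hξ j).2)
      rw [add_neg_cancel] at this
      exact (mem_fixedPointAlgebra_iff σ _).2 this
    refine ⟨⟨_, mul_mem hpmem (η j).2, hfix⟩, ?_, ?_, rfl⟩
    · have htwist : ‖conjTwist β ⟨_, hpmem⟩‖ ≤ D * (Real.pi * C) := by
        rw [conjTwist, norm_star]
        refine (hβ (star (spectralProj σ k a)) (star_mem hpmem)
          (star_mem_spectralSubspace hpk)).trans ?_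
        rw [norm_star]
        gcongr
      refine (hleib ⟨_, hpmem⟩ (η j)).trans ?_
      gcongr
    · refine (norm_mul_le _ _).trans ?_
      rw [norm_star]
      gcongr
  · simp only [mul_assoc]
    rw [← Finset.mul_sum, hξ1, mul_one]

end LipschitzBalls

theorem theoremt {A : Type*} [CStarAlgebra A] [PartialOrder A] [StarOrderedRing A]
    {B : Type*} [CStarAlgebra B]
    -- a strongly continuous circle action on `A`
    (σ : Circle →* (A ≃⋆ₐ[ℂ] A)) (hσ : IsStronglyContinuous σ)
    -- a norm-dense unital *-subalgebra of `A`
    (𝒜 : StarSubalgebra ℂ A) (hdense : Dense (𝒜 : Set A))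
    -- the twist `β_i`, a unital algebra homomorphism
    (β : 𝒜 →ₐ[ℂ] B)
    (L Lβ : SlipNorm (OperatorSystem.ofStarSubalgebra 𝒜))
    -- condition 1
    (hinv : ∀ (z : Circle) (a : A), a ∈ 𝒜 → σ z a ∈ 𝒜)
    (hLip : (𝒜 : Set A) ⊆ circleLip σ)
    -- condition 2
    (hP : ∀ a ∈ 𝒜, spectralProj σ 0 a ∈ 𝒜)
    (hR : ∃ (k : ℕ) (ζ : Fin k → A), (∀ j, ζ j ∈ 𝒜 ∧ ζ j ∈ spectralSubspace σ 1) ∧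
      ∑ j, ζ j * star (ζ j) = 1)
    (hL : ∃ (m : ℕ) (ζ : Fin m → A), (∀ j, ζ j ∈ 𝒜 ∧ ζ j ∈ spectralSubspace σ 1) ∧
      ∑ j, star (ζ j) * ζ j = 1)
    -- condition 3
    (hdom : ∃ C : ℝ, 0 ≤ C ∧ ∀ (a : A) (ha : a ∈ 𝒜),
      circleSlip σ a ≤ C * L ⟨a, ha⟩ ∧ Lβ ⟨a, ha⟩ ≤ C * L ⟨a, ha⟩)
    -- condition 4
    (hleib : ∀ a b : 𝒜, Lβ ⟨a * b, (a * b).2⟩ ≤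
      Lβ ⟨a, a.2⟩ * ‖β b‖ + ‖conjTwist β a‖ * Lβ ⟨b, b.2⟩)
    (hext : ∃ β₀ : fixedPointAlgebra σ →⋆ₐ[ℂ] B,
      ∀ (a : A) (ha : a ∈ 𝒜) (ha₀ : a ∈ fixedPointAlgebra σ), β₀ ⟨a, ha₀⟩ = β ⟨a, ha⟩)
    -- condition 5
    (hlsc : Lβ.IsLSC)
    (hLβinv : ∀ (z : Circle) (a : A) (ha : a ∈ 𝒜), Lβ ⟨σ z a, hinv z a ha⟩ = Lβ ⟨a, ha⟩)
    -- condition 6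
    (hcqms : (Lβ.restrict (F := OperatorSystem.ofStarSubalgebra (𝒜 ⊓ fixedPointAlgebra σ))
      (fun _ hx => hx.1)).IsCompactQuantumMetric) :
    L.IsCompactQuantumMetric := by
  -- if there are no states, both topologies live on an empty type
  rcases isEmpty_or_nonempty (StateSpace (OperatorSystem.ofStarSubalgebra 𝒜)) with _ | ⟨⟨φ'⟩⟩
  · exact Subsingleton.elim _ _
  let φ : StateSpace (OperatorSystem.ofStarSubalgebra (𝒜 ⊓ fixedPointAlgebra σ)) :=
    φ'.restrict fun _ hx => hx.1
  obtain ⟨C, hC, hCdom⟩ := hdom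
  have hfix (a : A) : spectralProj σ 0 a ∈ fixedPointAlgebra σ :=
    (mem_fixedPointAlgebra_iff σ _).2 (spectralProj_mem_spectralSubspace hσ 0 a)
  have hplus (n : ℕ) := exists_sum_star_mul_self_eq_one hL n
  have hminus (n : ℕ) := exists_sum_star_mul_self_eq_one (σ := σ) (𝒜 := 𝒜) (d := -1) (by
    obtain ⟨k, ζ, hζ, hζ1⟩ := hR
    exact ⟨k, fun j => star (ζ j), fun j => ⟨star_mem (hζ j).1,
      star_mem_spectralSubspace (hζ j).2⟩, by simpa using hζ1⟩) n
  -- the unit ball of `L` modulo the scalars, normalized by means of the state `φ ∘ P₀`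
  let T : Set A := {a | ∃ ha : a ∈ 𝒜, L ⟨a, ha⟩ ≤ 1 ∧ φ ⟨_, hP a ha, hfix a⟩ = 0}
  let V : Set A := {a | ∃ ha : a ∈ 𝒜, L ⟨a, ha⟩ ≤ 1}
  have hV : ∀ a ∈ V, ∃ ha : a ∈ 𝒜,
      a ∈ circleLip σ ∧ circleSlip σ a ≤ C ∧ Lβ ⟨a, ha⟩ ≤ C := by
    rintro a ⟨ha, haL⟩
    have := mul_le_of_le_one_right hC haL
    exact ⟨ha, hLip ha, (hCdom a ha).1.trans this, (hCdom a ha).2.trans this⟩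
  have hTV : T ⊆ V := fun a ⟨ha, haL, _⟩ => ⟨ha, haL⟩
  have hTB (n : ℤ) : TotallyBounded (spectralProj σ n '' T) := by
    rcases eq_or_ne n 0 with rfl | hn
    · refine (hcqms.totallyBounded φ C).subset ?_
      rintro _ ⟨a, ⟨ha, haL, haφ⟩, rfl⟩
      obtain ⟨_, -, -, haβ⟩ := hV a ⟨ha, haL⟩
      exact ⟨⟨_, hP a ha, hfix a⟩,
        (hlsc.apply_spectralProj_le hσ hinv hLβinv 0 ha (hP a ha)).trans haβ, haφ, rfl⟩
    · have hpos (m : ℕ) (hm : (m : ℤ) ≠ 0) : TotallyBounded (spectralProj σ m '' V) :=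
        totallyBounded_image_spectralProj hσ β Lβ hinv hP hleib hext hlsc hLβinv hcqms φ hm
          (by simpa using hplus m) (by simpa using hminus m) hV
      obtain ⟨m, rfl | rfl⟩ := n.eq_nat_or_neg
      · exact (hpos m hn).subset (Set.image_mono hTV)
      · -- `P_{-m} a = (P_m a*)*`, and the unit ball of `L` is stable under the adjoint
        have hcomp := (hpos m (by simpa using hn)).closure.isCompact_of_isClosed isClosed_closure
        refine (hcomp.image continuous_star).totallyBounded.subset ?_
        rintro _ ⟨a, ⟨ha, haL, -⟩, rfl⟩
        refine ⟨spectralProj σ m (star a), subset_closure ⟨star a, ⟨star_mem ha, ?_⟩, rfl⟩, ?_⟩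
        · exact (L.map_star' a ha).trans_le haL
        · rw [star_spectralProj hσ, star_star]
  have hT : TotallyBounded T := by
    refine Metric.totallyBounded_iff.2 fun ε hε => ?_
    have hC1 : 0 < C + 1 := by linarith
    obtain ⟨m, c, n, happrox⟩ := exists_norm_sub_sum_spectralProj_le hσ
      (ε := ε / (2 * (C + 1))) (by positivity)
    have hsum := totallyBounded_image_sum (fun j : Fin m => hTB (n j))
      (g := fun j y => c j • y) (fun j => continuous_const_smul _)
    obtain ⟨F, hF, hcover⟩ := Metric.totallyBounded_iff.1 hsum (ε / 2) (by positivity)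
    refine ⟨F, hF, fun a ha => ?_⟩
    obtain ⟨_, halip, haC, -⟩ := hV a (hTV ha)
    have h1 : ‖a - ∑ j : Fin m, c j • spectralProj σ (n j) a‖ < ε / 2 := by
      rw [← Finset.sum_range fun j => c j • spectralProj σ (n j) a]
      refine (happrox a halip).trans_lt ?_
      rw [div_mul_eq_mul_div, div_lt_div_iff₀ (by positivity) two_pos]
      nlinarith
    obtain ⟨y, hy, hay⟩ := Set.mem_iUnion₂.1 (hcover
      ⟨fun j => spectralProj σ (n j) a, fun j _ => ⟨a, ha, rfl⟩, rfl⟩)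
    refine Set.mem_iUnion₂.2 ⟨y, hy, ?_⟩
    rw [Metric.mem_ball] at hay ⊢
    rw [← dist_eq_norm] at h1
    exact (dist_triangle _ _ _).trans_lt (by linarith)
  refine SlipNorm.isCompactQuantumMetric_of_totallyBounded hT (fun a ha => ha.1) fun x hx => ?_
  have hφ1 : φ ⟨1, OperatorSystem.one_mem' _⟩ = 1 := φ.map_one'
  let c : ℂ := φ ⟨_, hP x x.2, hfix x⟩
  let e : (OperatorSystem.ofStarSubalgebra 𝒜).toSubmodule := ⟨1, OperatorSystem.one_mem' _⟩
  have hL1 : L e = 0 := L.map_one'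
  refine ⟨c, (x - c • e).2, ?_, ?_⟩
  · calc L (x - c • e) ≤ L x + L (c • e) := map_sub_le_add L.toSeminorm _ _
      _ ≤ 1 := by rw [map_smul_eq_mul, hL1, mul_zero, add_zero]; exact hx
  · have h1 : (⟨_, hP _ (x - c • e).2, hfix _⟩ :
        (OperatorSystem.ofStarSubalgebra (𝒜 ⊓ fixedPointAlgebra σ)).toSubmodule)
        = ⟨_, hP x x.2, hfix x⟩ - c • ⟨1, OperatorSystem.one_mem' _⟩ :=
      Subtype.ext (spectralProj_zero_sub_smul_one hσ x c)
    refine (congrArg φ.toLinearMap h1).trans ?_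
    rw [map_sub, map_smul, hφ1, smul_eq_mul, mul_one]
    exact sub_self c
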